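/- \textbf{Theorem (SeqRLSP resources).} Let $\Sigma=\{0,1\}$. For a regular language $L\subseteq\Sigma^*$ and $N\in\mathbb N$ with $L\cap\Sigma^N\neq\emptyset$, the regular language state (RLS) of $L$ on $N$ qubits is $|L_N\rangle=|L\cap\Sigma^N|^{-1/2}\sum_{w\in L\cap\Sigma^N}|w\rangle$; the complement RLS is the RLS $|\bar L_N\rangle$ of $\bar L=\Sigma^*\setminus L$ (defined when $\bar L\cap\Sigma^N\neq\emptyset$). The maximal Schmidt rank of $|\psi\rangle\in(\mathbb C^2)^{\otimes N}$ is $\chi(\psi)=\max_n\operatorname{rank}\Psi_{(n)}$, where $\Psi_{(n)}$ is the $2^n\times2^{N-n}$ matrix of amplitudes for the cut after the first $n$ qubits (for $N\le 1$, where there is no nontrivial cut, $\chi=1$). Elementary gates are arbitrary one-qubit unitaries and CNOT. A circuit on qubits $1,\dots,N$ is linear-nearest-neighbour (LNN) if each CNOT acts on adjacent qubits $i,i+1$; its depth is its critical-path depth. The sequential pipeline SeqRLSP takes $N$ and a description of $L$ (a finite set of strings of length $N$, a regular expression, a DFA, or a layered acyclic DFA for words of length $N$) and an optional complement flag, and: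 (1) forms a minimal automaton for $L$ (or $\bar L$ if flagged) -- layered if the description is a set of strings or a layered DFA (then only the words of length $N$ matter); (2) writes it as an open-boundary matrix product state (MPS) whose tensors are the adjacency matrices of the transitions; (3) performs two sweeps of compact singular value decompositions along the chain, left-to-right and then right-to-left, normalizing at the end, which gives MPS tensors $A_{[1]},\dots,A_{[N]}$ of bond dimensions $D_0=1,D_1,\dots,D_N=1$; (4) pads each tensor to an isometry $V_{[n]}$ from $\lceil\log_2D_{n-1}\rceil$ to $1+\lceil\log_2D_n\rceil$ qubits, $V_{[n]}|\alpha\rangle=\sum_{x,\beta}(A_{[n]}^x)_{\alpha\beta}|x\rangle|\beta\rangle$ for $\alpha<D_{n-1}$; (5) replaces each $V_{[n]}$ by a circuit of elementary gates given by a synthesis subroutine, which exactly implements any isometry from $k$ to $m\ge \max(k,1)$ qubits on $k$ input qubits and $m-k$ qubits in $|0\rangle$; and (6) applies these circuits for $n=1,\dots,N$ in this order, the $n$-th one on the consecutive qubits starting at qubit $n$. There are a synthesis subroutine and an absolute constant $C$ such that the following holds for every $N$, every regular language $L$, every description of $L$ as above, and either setting of the complement flag. Let $|\psi\rangle$ be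 the target state, $|L_N\rangle$ without the flag and $|\bar L_N\rangle$ with it, and assume that it is defined. Then the pipeline has an output, and whatever choices are made in the minimization, the decompositions and the padding, its output is an LNN circuit on the $N$ qubits alone (no ancilla qubits) that maps $|0^N\rangle$ exactly to $|\psi\rangle$ and has at most $C\chi^2N$ elementary gates and depth at most $C\chi^2N$, where $\chi=\chi(\psi)$. If $|L_N\rangle$ is defined, the same two bounds also hold, for either setting of the flag, with $\chi=\chi(|L_N\rangle)$. -/

import Mathlib

open scoped Matrix

noncomputable section

namespace RLSP

/-! ### Words, languages and states

A word of length `N` over the alphabet `{0,1}` is a function `Fin N → Fin 2`; it also labels a vector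
of the computational basis of the register of `N` qubits. -/

/-- The amplitudes of a vector of the register of the qubits `ι`. -/
abbrev Ket (ι : Type) : Type := (ι → Fin 2) → ℂ

/-- The computational basis vector `|x⟩`. -/
def ket {ι : Type} (x : ι → Fin 2) : Ket ι := by
  classical exact Pi.single x 1

/-- `L ∩ Σ^N`. -/
def wordsOfLength (L : Language (Fin 2)) (N : ℕ) : Set (Fin N → Fin 2) :=
  {w | List.ofFn w ∈ L}

/-- The uniform superposition of a set `S` of words. -/
def uniformState {N : ℕ} (S : Set (Fin N → Fin 2)) : Ket (Fin N) := by
  classical exact fun w => if w ∈ S then ((1 / Real.sqrt (S.ncard : ℝ) : ℝ) : ℂ) else 0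

/-- The regular language state `|L_N⟩`. -/
def rls (L : Language (Fin 2)) (N : ℕ) : Ket (Fin N) :=
  uniformState (wordsOfLength L N)

/-- The language `L`, or its complement `Σ^* \ L` when the flag is set. -/
def targetLanguage (L : Language (Fin 2)) (compl : Bool) : Language (Fin 2) :=
  if compl then Lᶜ else L

/-! ### Schmidt rank -/

/-- The amplitudes of `ψ` as a matrix: rows are labelled by the values of the first `n` qubits,
columns by the values of the other qubits. -/
def reshape {N : ℕ} (ψ : Ket (Fin N)) (n : ℕ) :
    Matrix ({i : Fin N // i.val < n} → Fin 2) ({i : Fin N // ¬ i.val < n} → Fin 2) ℂ :=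
  Matrix.of fun a b => ψ fun i => if h : i.val < n then a ⟨i, h⟩ else b ⟨i, h⟩

/-- The Schmidt rank across the cut after the first `n` qubits. -/
def schmidtRank {N : ℕ} (ψ : Ket (Fin N)) (n : ℕ) : ℕ := (reshape ψ n).rank

/-- The maximal Schmidt rank. The trivial cuts `0` and `N`, of rank one for `ψ ≠ 0`, do not change
the maximum over `1 ≤ n ≤ N - 1`; they give the value one where there is no other cut. -/
def maxSchmidtRank {N : ℕ} (ψ : Ket (Fin N)) : ℕ :=
  (Finset.range (N + 1)).sup (schmidtRank ψ)

/-! ### Circuits of elementary gates -/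

/-- Elementary gates on qubits labelled by `ι`: arbitrary one-qubit unitaries, and CNOT. -/
inductive Gate (ι : Type) : Type
  | single (q : ι) (u : Matrix.unitaryGroup (Fin 2) ℂ) : Gate ι
  | cnot (control target : ι) (h : control ≠ target) : Gate ι

/-- A circuit: its gates in the order in which they are applied. -/
abbrev Circuit (ι : Type) : Type := List (Gate ι)

namespace Gate

variable {ι κ : Type}

/-- The unitary of a gate on the whole register. On `Fin 2`, addition is the exclusive or. -/
def matrix [Fintype ι] [DecidableEq ι] : Gate ι → Matrix (ι → Fin 2) (ι → Fin 2) ℂ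
  | single q u => Matrix.of fun x y =>
      if ∀ j, j ≠ q → x j = y j then (u : Matrix (Fin 2) (Fin 2) ℂ) (x q) (y q) else 0
  | cnot c t _ => Matrix.of fun x y => if x = Function.update y t (y t + y c) then 1 else 0

/-- The qubits on which a gate acts. -/
def support [DecidableEq ι] : Gate ι → Finset ι
  | single q _ => {q}
  | cnot c t _ => {c, t}

/-- The same gate on other qubits. -/
def relabel (f : ι ↪ κ) : Gate ι → Gate κ
  | single q u => single (f q) u
  | cnot c t h => cnot (f c) (f t) (f.injective.ne h)

/-- A gate is executable on a line of qubits if it acts on one qubit or on two adjacent ones. -/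
def IsLNN {N : ℕ} : Gate (Fin N) → Prop
  | single _ _ => True
  | cnot c t _ => c.val + 1 = t.val ∨ t.val + 1 = c.val

end Gate

namespace Circuit

variable {ι κ : Type}

/-- The unitary of a circuit. -/
def matrix [Fintype ι] [DecidableEq ι] : Circuit ι → Matrix (ι → Fin 2) (ι → Fin 2) ℂ
  | [] => 1
  | g :: c => matrix c * g.matrix

/-- The number of elementary gates. -/
def size (c : Circuit ι) : ℕ := List.length c

/-- The number of time steps after which each qubit is free again, when every gate is executed as
soon as all its qubits are free; `t` is the state of these clocks at the start. -/
def clocks [DecidableEq ι] : Circuit ι → (ι → ℕ) → ι → ℕ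
  | [], t => t
  | g :: c, t => clocks c fun q => if q ∈ g.support then g.support.sup t + 1 else t q

/-- The depth: the length of the longest chain of gates that have to wait for one another. -/
def depth [Fintype ι] [DecidableEq ι] (c : Circuit ι) : ℕ :=
  Finset.univ.sup (clocks c fun _ => 0)

/-- The same circuit on other qubits. -/
def relabel (f : ι ↪ κ) (c : Circuit ι) : Circuit κ := List.map (Gate.relabel f) c

/-- A linear-nearest-neighbour circuit. -/
def IsLNN {N : ℕ} (c : Circuit (Fin N)) : Prop := ∀ g ∈ c, Gate.IsLNN g

/-- The circuit maps `|0…0⟩` to `ψ`. -/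
def Prepares [Fintype ι] [DecidableEq ι] (c : Circuit ι) (ψ : Ket ι) : Prop :=
  matrix c *ᵥ ket 0 = ψ

end Circuit

/-! ### Automata -/

/-- Deterministic finite automata with partial transition function. -/
structure PDFA where
  numStates : ℕ
  step : Fin numStates → Fin 2 → Option (Fin numStates)
  start : Fin numStates
  accept : Finset (Fin numStates)

namespace PDFA

/-- The state reached from `q` by reading a list of letters, if no transition is missing. -/
def run (F : PDFA) : Fin F.numStates → List (Fin 2) → Option (Fin F.numStates)
  | q, [] => some q
  | q, x :: w => (F.step q x).bind fun p => F.run p w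

/-- The accepted language. -/
def language (F : PDFA) : Language (Fin 2) :=
  {w | ∃ q ∈ F.accept, F.run F.start w = some q}

/-- No automaton with the same language has fewer states. -/
def IsMinimal (F : PDFA) : Prop :=
  ∀ G : PDFA, G.language = F.language → F.numStates ≤ G.numStates

end PDFA

/-- Layered (directed acyclic) automata for words of length `N`: layer `i` has the states
`Fin (width i)` for `0 ≤ i ≤ N`, and the unique state of layer `N` is the accepting one. Data at
positions beyond `N` play no role. -/
structure DagDFA (N : ℕ) where
  width : ℕ → ℕ
  step : (i : ℕ) → Fin (width i) → Fin 2 → Option (Fin (width (i + 1)))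
  width_zero : width 0 = 1
  width_last : width N = 1

namespace DagDFA

variable {N : ℕ}

/-- The words with a complete run `q_0, …, q_N` through the layers. -/
def words (G : DagDFA N) : Set (Fin N → Fin 2) :=
  {w | ∃ q : (i : Fin (N + 1)) → Fin (G.width i),
    ∀ i : Fin N, G.step i (q i.castSucc) (w i) = some (q i.succ)}

/-- The total number of states. -/
def numStates (G : DagDFA N) : ℕ := ∑ i ∈ Finset.range (N + 1), G.width i

/-- No layered automaton for the same words has fewer states. -/
def IsMinimal (G : DagDFA N) : Prop :=
  ∀ H : DagDFA N, H.words = G.words → G.numStates ≤ H.numStates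

end DagDFA

/-! ### Matrix product states -/

/-- Matrix product states of `N` qubits with open boundary conditions. The sites are numbered from
`0`; the tensor of site `n` has bond dimensions `D n` and `D (n + 1)`, and the amplitude of `w` is the
entry of the `1 × 1` matrix `A 0 (w 0) * ⋯ * A (N - 1) (w (N - 1))`. Data at sites beyond `N - 1` play
no role. -/
structure MPS (N : ℕ) where
  D : ℕ → ℕ
  A : (n : ℕ) → Fin 2 → Matrix (Fin (D n)) (Fin (D (n + 1))) ℂ
  D_zero : D 0 = 1
  D_last : D N = 1

/-- The matrix product state of an automaton: all tensors are the adjacency matrices of the transition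
graph, the initial state is absorbed into the first tensor, and the indicator vector of the accepting
states into the last one. -/
def PDFA.toMPS (F : PDFA) (N : ℕ) : MPS N where
  D n := if n = 0 ∨ n = N then 1 else F.numStates
  A n x := Matrix.of fun i j => ∑ p, ∑ q,
    (if n = 0 then (if p = F.start then 1 else 0) else (if p.val = i.val then 1 else 0)) *
    (if F.step p x = some q then 1 else 0) *
    (if n + 1 = N then (if q ∈ F.accept then 1 else 0) else (if q.val = j.val then 1 else 0))
  D_zero := by simp
  D_last := by simp

/-- The matrix product state of a layered automaton. -/
def DagDFA.toMPS {N : ℕ} (G : DagDFA N) : MPS N where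
  D := G.width
  A n x := Matrix.of fun i j => if G.step n i x = some j then 1 else 0
  D_zero := G.width_zero
  D_last := G.width_last

/-! ### Canonical form by two sweeps of singular value decompositions -/

/-- `M = U · diag(s) · Vᴴ` is a compact singular value decomposition. -/
structure IsCompactSVD {m n : Type} [Fintype m] [Fintype n] {r : ℕ} (M : Matrix m n ℂ)
    (U : Matrix m (Fin r) ℂ) (s : Fin r → ℝ) (V : Matrix n (Fin r) ℂ) : Prop where
  pos : ∀ i, 0 < s i
  left : Uᴴ * U = 1
  right : Vᴴ * V = 1
  eq : M = U * Matrix.diagonal (fun i => (s i : ℂ)) * Vᴴ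

/-- A tensor as a matrix from its right bond to its physical index and its left bond. -/
def leftMat {a b : ℕ} (T : Fin 2 → Matrix (Fin a) (Fin b) ℂ) : Matrix (Fin 2 × Fin a) (Fin b) ℂ :=
  Matrix.of fun p j => T p.1 p.2 j

/-- A tensor as a matrix from its physical index and its right bond to its left bond. -/
def rightMat {a b : ℕ} (T : Fin 2 → Matrix (Fin a) (Fin b) ℂ) : Matrix (Fin a) (Fin 2 × Fin b) ℂ :=
  Matrix.of fun i p => T p.1 i p.2

/-- `B` is a result of the left-to-right sweep on `M`. At each site but the last, the matrix `X n`
carried along is multiplied into the tensor, the product is decomposed as `U · diag(s) · Vᴴ`, `U` is the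
new tensor and `diag(s) · Vᴴ` is carried on; the last tensor absorbs what it receives. -/
def SweepRight {N : ℕ} (M B : MPS N) : Prop :=
  ∃ X : (n : ℕ) → Matrix (Fin (B.D n)) (Fin (M.D n)) ℂ,
    (∀ i j, X 0 i j = 1) ∧
    (∀ n, n + 1 < N → ∃ (s : Fin (B.D (n + 1)) → ℝ) (V : Matrix (Fin (M.D (n + 1))) (Fin (B.D (n + 1))) ℂ),
      IsCompactSVD (leftMat fun x => X n * M.A n x) (leftMat (B.A n)) s V ∧
      X (n + 1) = Matrix.diagonal (fun i => (s i : ℂ)) * Vᴴ) ∧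
    (∀ n, n + 1 = N → ∀ x i j j', B.A n x i j = (X n * M.A n x) i j')

/-- `A` is a result of the right-to-left sweep on `M`. At each site but the first, the matrix
`Y (n + 1)` carried along is multiplied into the tensor, the product is decomposed as
`U · diag(s) · Vᴴ`, `Vᴴ` is the new tensor and `U · diag(s)` is carried on; the first tensor absorbs what
it receives, and is normalized. -/
def SweepLeft {N : ℕ} (M A : MPS N) : Prop :=
  ∃ Y : (n : ℕ) → Matrix (Fin (M.D n)) (Fin (A.D n)) ℂ,
    (∀ i j, Y N i j = 1) ∧
    (∀ n, 0 < n → n < N → ∃ (s : Fin (A.D n) → ℝ) (U : Matrix (Fin (M.D n)) (Fin (A.D n)) ℂ),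
      IsCompactSVD (rightMat fun x => M.A n x * Y (n + 1)) U s (rightMat (A.A n))ᴴ ∧
      Y n = U * Matrix.diagonal (fun i => (s i : ℂ))) ∧
    (0 < N → ∀ x i i' j, A.A 0 x i j =
      (M.A 0 x * Y 1) i' j / (Real.sqrt (∑ y, ∑ k, ∑ l, ‖(M.A 0 y * Y 1) k l‖ ^ 2) : ℂ))

/-! ### From isometric tensors to circuits -/

/-- The number of qubits that hold a bond of dimension `d`, namely `⌈log₂ d⌉`. -/
def bondQubits (d : ℕ) : ℕ := Nat.clog 2 d

/-- The number written in binary by `k` bits. -/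
def code {k : ℕ} (p : Fin k → Fin 2) : ℕ := (finFunctionFinEquiv p).val

/-- `V` is an isometric matrix into which the tensor `T` is padded, with both bond dimensions raised to
powers of two: it maps the left bond state `|α⟩` to `∑ x β, T x α β |x⟩|β⟩`. On padding indices of the
left bond any completion to an isometry is allowed. -/
def IsPadding {a b : ℕ} (T : Fin 2 → Matrix (Fin a) (Fin b) ℂ)
    (V : Matrix (Fin (bondQubits b + 1) → Fin 2) (Fin (bondQubits a) → Fin 2) ℂ) : Prop :=
  Vᴴ * V = 1 ∧
  ∀ (α : Fin (bondQubits a) → Fin 2) (hα : code α < a) (x : Fin 2) (β : Fin (bondQubits b) → Fin 2),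
    V (Fin.cons x β) α = if hβ : code β < b then T x ⟨code α, hα⟩ ⟨code β, hβ⟩ else 0

/-- The bits `a` of the first `k` of `n` qubits, followed by zeros on the other qubits. -/
def padZeros {k : ℕ} (n : ℕ) (a : Fin k → Fin 2) : Fin n → Fin 2 :=
  fun i => if h : i.val < k then a ⟨i, h⟩ else 0

/-- A synthesis method: it turns every isometry `V` from `k` to `n ≥ 1` qubits into a circuit on `n` qubits
that implements `V` on states whose last `n - k` qubits are initialized to `|0⟩`. -/
structure IsometrySynthesis where
  circuit : {n k : ℕ} → Matrix (Fin n → Fin 2) (Fin k → Fin 2) ℂ → Circuit (Fin n)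
  correct : ∀ {n k : ℕ} (V : Matrix (Fin n → Fin 2) (Fin k → Fin 2) ℂ), 0 < n → k ≤ n → Vᴴ * V = 1 →
    ∀ a, (circuit V).matrix *ᵥ ket (padZeros n a) = fun x => V x a

/-! ### The pipeline -/

/-- The descriptions of a state of `N` qubits that a user can give. -/
inductive Input (N : ℕ) : Type
  | strings (S : Finset (Fin N → Fin 2)) : Input N
  | regex (r : RegularExpression (Fin 2)) : Input N
  | dfa (F : PDFA) : Input N
  | dagDFA (G : DagDFA N) : Input N

/-- The input describes the language `L` (for explicit strings and layered automata: its words of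
length `N`). -/
def Input.Describes {N : ℕ} (L : Language (Fin 2)) : Input N → Prop
  | .strings S => (S : Set (Fin N → Fin 2)) = wordsOfLength L N
  | .regex r => r.matches' = L
  | .dfa F => F.language = L
  | .dagDFA G => G.words = wordsOfLength L N

/-- `M` is the matrix product state of a minimal automaton for the described language, or for its
complement when the flag is set: a layered automaton for explicit strings and layered automata, an
ordinary one for the other inputs. The automata from which the minimal one is computed matter only
through their language. -/
def Input.InitialMPS {N : ℕ} (compl : Bool) (M : MPS N) : Input N → Prop
  | .strings S => ∃ G : DagDFA N, G.IsMinimal ∧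
      G.words = (if compl then (S : Set (Fin N → Fin 2))ᶜ else S) ∧ M = G.toMPS
  | .regex r => ∃ F : PDFA, F.IsMinimal ∧ F.language = targetLanguage r.matches' compl ∧ M = F.toMPS N
  | .dfa F₀ => ∃ F : PDFA, F.IsMinimal ∧ F.language = targetLanguage F₀.language compl ∧ M = F.toMPS N
  | .dagDFA G₀ => ∃ G : DagDFA N, G.IsMinimal ∧
      G.words = (if compl then G₀.wordsᶜ else G₀.words) ∧ M = G.toMPS

/-- The embedding of `m` qubits as the consecutive qubits `n, n + 1, …, n + m - 1` of a line. -/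
def window (n m : ℕ) : Fin m ↪ ℕ := Fin.valEmbedding.trans (addLeftEmbedding n)

/-- `c` is an output of the sequential pipeline with the synthesis method `synth`, on a line of qubits
numbered by `0, 1, 2, …`. The automaton is turned into a matrix product state, brought into canonical
form by two sweeps, and padded. The circuits of the resulting isometries are applied one after the other;
the one of site `n` starts at qubit `n`, where it finds the state of the left bond, leaves the physical
index of the site on qubit `n` and the state of the right bond on the qubits after it. -/
def SeqRLSP {N : ℕ} (synth : IsometrySynthesis) (inp : Input N) (compl : Bool) (c : Circuit ℕ) : Prop :=
  ∃ (M B A : MPS N)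
    (V : (n : ℕ) → Matrix (Fin (bondQubits (A.D (n + 1)) + 1) → Fin 2) (Fin (bondQubits (A.D n)) → Fin 2) ℂ),
    inp.InitialMPS compl M ∧ SweepRight M B ∧ SweepLeft B A ∧
    (∀ n, n < N → IsPadding (A.A n) (V n)) ∧
    c = (List.range N).flatMap fun n => (synth.circuit (V n)).relabel (window n _)

end RLSP

end

/-!
The size bound has two ingredients: every bond dimension of the canonical form is at most the Schmidt
rank of the target at that cut, and every isometry from `k` to `n` qubits takes `O(2 ^ (k + n))`
nearest-neighbour gates. As a bond of dimension `D ≤ χ` occupies fewer than `1 + log₂ D` qubits, each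
site then costs `O(χ ^ 2)` gates. The depth is at most the number of gates.

*Bond dimensions.* The first sweep makes all tensors but the last isometric from left to right, so the
amplitudes of prefixes form a matrix with orthonormal columns. In the second sweep the amplitudes of
prefixes of the result are, up to normalization, these columns times `U · diag(s)`, which is injective,
while the amplitudes of suffixes have orthonormal rows. Hence the amplitudes, as a matrix
for the cut `n`, are a product of a matrix with a left inverse and one with a right inverse, and
the bond dimension is at most the rank (`sweeps_spec`). The automaton matters only through its language:
the matrix product state of a deterministic automaton has amplitude one on the accepted words and
zero elsewhere (`Input.InitialMPS.amp_eq`), and the right-canonical normalized form turns this into the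
uniform superposition (`amp_eq_uniformState`).

*Synthesis.* A phase on `l + 1` qubits that is odd under a flip of the last one splits, on the farthest
qubit, into two such phases with one qubit less, the second conjugated by a CNOT across the line. With
`O(l)` neighbouring CNOTs for a long one, the cost satisfies `T(l + 1) = 2 T(l) + O(l)`, so it is
`O(2 ^ l)` (`exists_phase_of_odd`). Summing over the qubits gives all diagonal unitaries
(`exists_phase`); two of them per qubit prepare an arbitrary state (`exists_prepares`). A Householder
reflection is a preparation, a phase on `|0…0⟩` and the inverse preparation (`exists_reflection`),
and `2 ^ k` reflections realize an isometry on `k` qubits (`exists_isometry_circuit`).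

*The circuit.* By induction from the right end, the circuits of the sites `n, n + 1, …` turn the bond
state `|α⟩` into the state of the remaining tensors (`exists_sequential_circuit`). The inequality
`⌈log₂ D_n⌉ ≤ 1 + ⌈log₂ D_{n+1}⌉` and `D_N = 1` keep all windows inside the `N` qubits.

*Complement.* The amplitude matrices of a set of words and of its complement are, up to factors, `P` and
`J - P` with the all-ones matrix `J` of rank one, so the maximal Schmidt ranks differ by a factor of at
most two (`maxSchmidtRank_targetLanguage_le`).
-/

noncomputable section

namespace RLSP

/-! ### The action of circuits on states -/

theorem Circuit.relabel_append {ι κ : Type} (f : ι ↪ κ) (c d : Circuit ι) :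
    Circuit.relabel f (c ++ d) = Circuit.relabel f c ++ Circuit.relabel f d :=
  List.map_append

theorem Circuit.relabel_relabel {ι κ μ : Type} (f : ι ↪ κ) (g : κ ↪ μ) (c : Circuit ι) :
    (c.relabel f).relabel g = c.relabel (f.trans g) := by
  simp only [Circuit.relabel, List.map_map]
  congr 1
  funext a
  cases a <;> rfl

/-- The inverse of an elementary gate. -/
def Gate.inv {ι : Type} : Gate ι → Gate ι
  | .single q u => .single q (star u)
  | .cnot c t h => .cnot c t h

/-- The inverse circuit. -/
def Circuit.inv {ι : Type} (c : Circuit ι) : Circuit ι := (c.map Gate.inv).reverse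

theorem Circuit.inv_size {ι : Type} (c : Circuit ι) : c.inv.size = c.size := by
  simp [Circuit.inv, Circuit.size]

/-- The map on bit strings behind a CNOT is an involution. -/
theorem update_cnot_involutive {ι : Type} [DecidableEq ι] (c t : ι) (h : c ≠ t) (x : ι → Fin 2) :
    Function.update (Function.update x t (x t + x c)) t
      (Function.update x t (x t + x c) t + Function.update x t (x t + x c) c) = x := by
  funext j
  by_cases hj : j = t
  · subst hj
    simp only [Function.update_self, Function.update_of_ne h]
    generalize x j = a
    generalize x c = b
    revert a b
    decide
  · simp [hj]

theorem ket_apply {ι : Type} [Fintype ι] (x y : ι → Fin 2) :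
    (ket x : Ket ι) y = if y = x then 1 else 0 := by
  classical
  simp [ket, Pi.single_apply]

section Semantics

variable {ι κ : Type} [Fintype ι] [DecidableEq ι] [Fintype κ] [DecidableEq κ]

theorem Gate.single_mulVec (q : ι) (u : Matrix.unitaryGroup (Fin 2) ℂ) (ψ : Ket ι)
    (x : ι → Fin 2) :
    ((Gate.single q u).matrix *ᵥ ψ) x =
      ∑ b, (u : Matrix (Fin 2) (Fin 2) ℂ) (x q) b * ψ (Function.update x q b) := by
  simp only [Matrix.mulVec, dotProduct, Gate.matrix, Matrix.of_apply]
  symm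
  refine Fintype.sum_of_injective (fun b => Function.update x q b)
    (Function.update_injective x q) _ _ ?_ ?_
  · intro y hy
    rw [if_neg, zero_mul]
    intro h
    refine hy ⟨y q, ?_⟩
    funext j
    by_cases hj : j = q
    · subst hj; simp
    · simp [hj, h j hj]
  · intro b
    rw [if_pos]
    · simp
    · intro j hj
      simp [hj]

theorem Gate.cnot_mulVec (c t : ι) (h : c ≠ t) (ψ : Ket ι) (x : ι → Fin 2) :
    ((Gate.cnot c t h).matrix *ᵥ ψ) x = ψ (Function.update x t (x t + x c)) := by
  simp only [Matrix.mulVec, dotProduct, Gate.matrix, Matrix.of_apply]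
  rw [Finset.sum_eq_single (Function.update x t (x t + x c))]
  · rw [if_pos (update_cnot_involutive c t h x).symm, one_mul]
  · intro y _ hy
    rw [if_neg, zero_mul]
    rintro rfl
    exact hy (update_cnot_involutive c t h y).symm
  · simp

theorem Circuit.nil_mulVec (ψ : Ket ι) : Circuit.matrix ([] : Circuit ι) *ᵥ ψ = ψ := by
  simp [Circuit.matrix]

theorem Circuit.cons_mulVec (g : Gate ι) (c : Circuit ι) (ψ : Ket ι) :
    Circuit.matrix (g :: c) *ᵥ ψ = Circuit.matrix c *ᵥ (g.matrix *ᵥ ψ) := by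
  simp [Circuit.matrix]

theorem Circuit.append_mulVec (c d : Circuit ι) (ψ : Ket ι) :
    Circuit.matrix (c ++ d) *ᵥ ψ = Circuit.matrix d *ᵥ (Circuit.matrix c *ᵥ ψ) := by
  induction c generalizing ψ with
  | nil => simp [Circuit.nil_mulVec]
  | cons g c ih => rw [List.cons_append, Circuit.cons_mulVec, ih, Circuit.cons_mulVec]

/-- A gate on a sub-register acts on the restrictions of the state to that sub-register, the other
qubits being held fixed. -/
theorem Gate.relabel_mulVec (f : ι ↪ κ) (g : Gate ι) (ψ : Ket κ) (y : κ → Fin 2) :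
    ((g.relabel f).matrix *ᵥ ψ) y =
      (g.matrix *ᵥ fun z => ψ (Function.extend f z y)) (y ∘ f) := by
  have key : ∀ (q : ι) (b : Fin 2),
      Function.extend f (Function.update (y ∘ f) q b) y = Function.update y (f q) b := by
    intro q b
    funext j
    by_cases hj : ∃ i, f i = j
    · obtain ⟨i, rfl⟩ := hj
      rw [f.injective.extend_apply]
      by_cases hi : i = q
      · subst hi; simp
      · rw [Function.update_of_ne hi, Function.update_of_ne (f.injective.ne hi)]; rfl
    · rw [Function.extend_apply' _ _ _ hj, Function.update_of_ne]
      rintro rfl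
      exact hj ⟨q, rfl⟩
  cases g with
  | single q u =>
    simp only [Gate.relabel, Gate.single_mulVec, key, Function.comp_apply]
  | cnot c t h =>
    simp only [Gate.relabel, Gate.cnot_mulVec, key, Function.comp_apply]

/-- The action of a circuit on a sub-register. -/
theorem Circuit.relabel_mulVec (f : ι ↪ κ) (c : Circuit ι) (ψ : Ket κ) (y : κ → Fin 2) :
    (Circuit.matrix (c.relabel f) *ᵥ ψ) y =
      (Circuit.matrix c *ᵥ fun z => ψ (Function.extend f z y)) (y ∘ f) := by
  induction c generalizing ψ with
  | nil =>
    change (Circuit.matrix ([] : Circuit κ) *ᵥ ψ) y = _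
    rw [Circuit.nil_mulVec, Circuit.nil_mulVec]
    congr 1
    funext j
    by_cases hj : ∃ i, f i = j
    · obtain ⟨i, rfl⟩ := hj
      rw [f.injective.extend_apply]; rfl
    · rw [Function.extend_apply' _ _ _ hj]
  | cons g c ih =>
    change (Circuit.matrix (g.relabel f :: Circuit.relabel f c) *ᵥ ψ) y = _
    rw [Circuit.cons_mulVec, ih, Circuit.cons_mulVec]
    congr 2
    funext z
    rw [Gate.relabel_mulVec]
    have h1 : Function.extend f z y ∘ f = z := by
      funext i; simp [f.injective.extend_apply]
    rw [h1]
    congr 2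
    funext z'
    congr 1
    funext j
    by_cases hj : ∃ i, f i = j
    · obtain ⟨i, rfl⟩ := hj
      rw [f.injective.extend_apply, f.injective.extend_apply]
    · rw [Function.extend_apply' _ _ _ hj, Function.extend_apply' _ _ _ hj,
        Function.extend_apply' _ _ _ hj]

theorem Gate.inv_matrix (g : Gate ι) : g.inv.matrix = g.matrixᴴ := by
  ext x y
  cases g with
  | single q u =>
    simp only [Gate.inv, Gate.matrix, Matrix.of_apply, Matrix.conjTranspose_apply]
    have h : (∀ j, j ≠ q → x j = y j) ↔ ∀ j, j ≠ q → y j = x j :=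
      ⟨fun h j hj => (h j hj).symm, fun h j hj => (h j hj).symm⟩
    by_cases hx : ∀ j, j ≠ q → x j = y j
    · rw [if_pos hx, if_pos (h.1 hx)]; rfl
    · rw [if_neg hx, if_neg (fun h' => hx (h.2 h')), star_zero]
  | cnot c t hct =>
    simp only [Gate.inv, Gate.matrix, Matrix.of_apply, Matrix.conjTranspose_apply]
    by_cases hx : x = Function.update y t (y t + y c)
    · rw [if_pos hx, if_pos, star_one]
      rw [hx]
      exact (update_cnot_involutive c t hct y).symm
    · rw [if_neg hx, if_neg, star_zero]
      intro hy
      refine hx ?_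
      rw [hy]
      exact (update_cnot_involutive c t hct x).symm

theorem Gate.mul_conjTranspose_matrix (g : Gate ι) : g.matrix * g.matrixᴴ = 1 := by
  refine Matrix.ext_of_mulVec_single fun y => ?_
  rw [← Matrix.mulVec_mulVec, ← Gate.inv_matrix, Matrix.one_mulVec]
  generalize (Pi.single y 1 : Ket ι) = ψ
  funext x
  cases g with
  | single q u =>
    have hu := Matrix.mem_unitaryGroup_iff.1 u.2
    simp only [Gate.inv, Gate.single_mulVec, Function.update_self, Function.update_idem,
      Finset.mul_sum]
    rw [Finset.sum_comm]
    simp only [← mul_assoc, ← Finset.sum_mul]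
    have h : ∀ b, ∑ i, (u : Matrix (Fin 2) (Fin 2) ℂ) (x q) i *
        ((star u : Matrix.unitaryGroup (Fin 2) ℂ) : Matrix (Fin 2) (Fin 2) ℂ) i b =
        if x q = b then 1 else 0 := by
      intro b
      have := congrFun (congrFun hu (x q)) b
      rw [Matrix.mul_apply, Matrix.one_apply] at this
      exact this
    simp only [h, ite_mul, one_mul, zero_mul, Finset.sum_ite_eq, Finset.mem_univ, if_true,
      Function.update_eq_self]
  | cnot c t hct =>
    simp only [Gate.inv, Gate.cnot_mulVec]
    rw [update_cnot_involutive c t hct]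

theorem Circuit.mul_conjTranspose_matrix (c : Circuit ι) : c.matrix * c.matrixᴴ = 1 := by
  induction c with
  | nil => simp [Circuit.matrix]
  | cons g c ih =>
    simp only [Circuit.matrix, Matrix.conjTranspose_mul]
    rw [Matrix.mul_assoc, ← Matrix.mul_assoc g.matrix, Gate.mul_conjTranspose_matrix, Matrix.one_mul, ih]

theorem Circuit.conjTranspose_mul_matrix (c : Circuit ι) : c.matrixᴴ * c.matrix = 1 :=
  mul_eq_one_comm.1 c.mul_conjTranspose_matrix

theorem Circuit.matrix_append (c d : Circuit ι) :
    Circuit.matrix (c ++ d) = d.matrix * c.matrix := by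
  induction c with
  | nil => simp [Circuit.matrix]
  | cons g c ih => rw [List.cons_append, Circuit.matrix, ih, Circuit.matrix, Matrix.mul_assoc]

theorem Circuit.inv_matrix (c : Circuit ι) : c.inv.matrix = c.matrixᴴ := by
  induction c with
  | nil => simp [Circuit.inv, Circuit.matrix]
  | cons g c ih =>
    have h : Circuit.inv (g :: c) = Circuit.inv c ++ [g.inv] := by simp [Circuit.inv]
    rw [h, Circuit.matrix_append, ih]
    simp [Circuit.matrix, Gate.inv_matrix]

/-- Circuits preserve inner products. -/
theorem Circuit.star_mulVec_dotProduct (c : Circuit ι) (x y : Ket ι) :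
    star (c.matrix *ᵥ x) ⬝ᵥ (c.matrix *ᵥ y) = star x ⬝ᵥ y := by
  rw [Matrix.star_mulVec, Matrix.dotProduct_mulVec, Matrix.vecMul_vecMul,
    c.conjTranspose_mul_matrix, Matrix.vecMul_one]

theorem star_ket_dotProduct (x : ι → Fin 2) (ψ : Ket ι) : star (ket x) ⬝ᵥ ψ = ψ x := by
  classical
  simp [dotProduct, ket_apply]

end Semantics

/-! ### Nearest-neighbour circuits -/

theorem Gate.inv_isLNN {n : ℕ} (g : Gate (Fin n)) (h : g.IsLNN) : g.inv.IsLNN := by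
  cases g <;> exact h

theorem Circuit.inv_isLNN {n : ℕ} {c : Circuit (Fin n)} (h : c.IsLNN) : c.inv.IsLNN := by
  intro g hg
  simp only [Circuit.inv, List.mem_reverse, List.mem_map] at hg
  obtain ⟨g', hg', rfl⟩ := hg
  exact g'.inv_isLNN (h g' hg')

theorem Circuit.isLNN_append {n : ℕ} {c d : Circuit (Fin n)} (hc : c.IsLNN) (hd : d.IsLNN) :
    Circuit.IsLNN (c ++ d) := by
  intro g hg
  rcases List.mem_append.1 hg with h | h
  exacts [hc g h, hd g h]

theorem Circuit.isLNN_nil {n : ℕ} : Circuit.IsLNN ([] : Circuit (Fin n)) := by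
  intro g hg; cases hg

theorem Circuit.isLNN_singleton {n : ℕ} {g : Gate (Fin n)} (h : g.IsLNN) :
    Circuit.IsLNN [g] := by
  intro g' hg
  rw [List.mem_singleton.1 hg]; exact h

/-- Relabelling by a translation of the line keeps neighbours adjacent. -/
theorem Circuit.relabel_isLNN {m n : ℕ} {c : Circuit (Fin m)} (h : c.IsLNN) (f : Fin m ↪ Fin n)
    (s : ℕ) (hf : ∀ i, (f i).val = i.val + s) : (c.relabel f).IsLNN := by
  intro g hg
  obtain ⟨g', hg', rfl⟩ := List.mem_map.1 hg
  have := h g' hg'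
  cases g' with
  | single q u => trivial
  | cnot a b hab =>
    simp only [Gate.IsLNN, Gate.relabel, hf] at this ⊢
    omega

theorem Circuit.size_append {ι : Type} (c d : Circuit ι) :
    Circuit.size (c ++ d) = c.size + d.size := List.length_append

theorem Circuit.size_relabel {ι κ : Type} (f : ι ↪ κ) (c : Circuit ι) :
    (c.relabel f).size = c.size := List.length_map _

/-! ### Diagonal unitaries on a line of qubits -/

/-- A CNOT between the two ends of a line is obtained from nearest-neighbour CNOTs: two of them
move the value of the first qubit to the second one, and two more restore it. -/
theorem exists_longCnot (l : ℕ) : ∃ c : Circuit (Fin (l + 2)), c.IsLNN ∧ c.size ≤ 4 * l + 1 ∧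
    ∀ (ψ : Ket (Fin (l + 2))) x, (c.matrix *ᵥ ψ) x =
      ψ (Function.update x (Fin.last _) (x (Fin.last _) + x 0)) := by
  induction l with
  | zero =>
    refine ⟨[.cnot 0 (Fin.last 1) (by decide)], Circuit.isLNN_singleton (Or.inl rfl), le_rfl, ?_⟩
    intro ψ x
    rw [Circuit.cons_mulVec, Circuit.nil_mulVec, Gate.cnot_mulVec]
  | succ l ih =>
    obtain ⟨c, hc, hs, hm⟩ := ih
    have h01 : (0 : Fin (l + 3)) ≠ 1 := by simp
    have hg1 : Circuit.IsLNN [Gate.cnot (1 : Fin (l + 3)) 0 h01.symm, Gate.cnot 0 1 h01] := by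
      intro g hg
      simp only [List.mem_cons, List.not_mem_nil, or_false] at hg
      rcases hg with rfl | rfl <;> simp [Gate.IsLNN]
    have hg2 : Circuit.IsLNN [Gate.cnot (0 : Fin (l + 3)) 1 h01, Gate.cnot 1 0 h01.symm] := by
      intro g hg
      simp only [List.mem_cons, List.not_mem_nil, or_false] at hg
      rcases hg with rfl | rfl <;> simp [Gate.IsLNN]
    refine ⟨[.cnot 1 0 h01.symm, .cnot 0 1 h01] ++ (c.relabel (Fin.succEmb _) ++
      [.cnot 0 1 h01, .cnot 1 0 h01.symm]), Circuit.isLNN_append hg1 (Circuit.isLNN_append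
        (Circuit.relabel_isLNN hc _ 1 fun i => rfl) hg2), ?_, ?_⟩
    · rw [Circuit.size_append, Circuit.size_append, Circuit.size_relabel]
      simp only [Circuit.size, List.length_cons, List.length_nil] at hs ⊢
      omega
    · intro ψ x
      rw [Circuit.append_mulVec, Circuit.append_mulVec]
      simp only [Circuit.cons_mulVec, Circuit.nil_mulVec, Gate.cnot_mulVec, Circuit.relabel_mulVec,
        hm]
      congr 1
      have hl0 : Fin.last (l + 2) ≠ 0 := by simp [Fin.ext_iff]
      have hl1 : Fin.last (l + 2) ≠ 1 := by simp [Fin.ext_iff]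
      have hs1 : (0 : Fin (l + 2)).succ = (1 : Fin (l + 3)) := rfl
      have hsl : (Fin.last (l + 1)).succ = Fin.last (l + 2) := rfl
      generalize hy : Function.update (Function.update x 0 (x 0 + x 1)) 1
        (Function.update x 0 (x 0 + x 1) 1 + Function.update x 0 (x 0 + x 1) 0) = y
      have hy0 : y 0 = x 0 + x 1 := by simp [← hy, h01]
      have hy1 : y 1 = x 0 := by
        simp only [← hy, Function.update_self, Function.update_of_ne h01.symm]
        generalize x 0 = a
        generalize x 1 = b
        revert a b; decide
      have hyj : ∀ j, j ≠ 0 → j ≠ 1 → y j = x j := by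
        intro j h0 h1; simp [← hy, h0, h1]
      generalize hz : Function.extend (Fin.succEmb (l + 2)) (Function.update (y ∘ Fin.succEmb (l + 2))
        (Fin.last (l + 1)) ((y ∘ Fin.succEmb (l + 2)) (Fin.last (l + 1)) +
          (y ∘ Fin.succEmb (l + 2)) 0)) y = z
      have hz0 : z 0 = x 0 + x 1 := by
        rw [← hz, Function.extend_apply', hy0]
        rintro ⟨i, hi⟩
        exact Fin.succ_ne_zero i hi
      have hzs : ∀ j : Fin (l + 2), z j.succ = Function.update (y ∘ Fin.succEmb (l + 2))
        (Fin.last (l + 1)) ((y ∘ Fin.succEmb (l + 2)) (Fin.last (l + 1)) +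
          (y ∘ Fin.succEmb (l + 2)) 0) j := by
        intro j
        rw [← hz]
        exact (Fin.succEmb (l + 2)).injective.extend_apply _ _ j
      have hz1 : z 1 = x 0 := by
        rw [← hs1, hzs, Function.update_of_ne (by simp [Fin.ext_iff])]
        exact hy1
      have hzl : z (Fin.last _) = x (Fin.last _) + x 0 := by
        rw [← hsl, hzs, Function.update_self]
        change y (Fin.last _) + y 1 = _
        rw [hy1, hyj _ hl0 hl1, hsl]
      have hzj : ∀ j, j ≠ 0 → j ≠ 1 → j ≠ Fin.last _ → z j = x j := by
        intro j h0 h1 h2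
        obtain ⟨i, rfl⟩ := Fin.exists_succ_eq.2 h0
        rw [hzs, Function.update_of_ne (by rintro rfl; exact h2 rfl)]
        exact hyj _ h0 h1
      funext j
      by_cases hj0 : j = 0
      · subst hj0
        rw [Function.update_self, Function.update_of_ne hl0.symm, Function.update_self,
          Function.update_of_ne h01, hz0, hz1]
        generalize x 0 = a
        generalize x 1 = b
        revert a b; decide
      · rw [Function.update_of_ne hj0]
        by_cases hj1 : j = 1
        · subst hj1
          rw [Function.update_self, Function.update_of_ne hl1.symm, hz0, hz1]
          generalize x 0 = a
          generalize x 1 = b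
          revert a b; decide
        · rw [Function.update_of_ne hj1]
          by_cases hjl : j = Fin.last _
          · subst hjl
            rw [hzl, Function.update_self]
          · rw [Function.update_of_ne hjl, hzj j hj0 hj1 hjl]

/-- The circuit multiplies the basis vector `|x⟩` by `exp (i f(x))`. -/
def ActsAsPhase {n : ℕ} (c : Circuit (Fin n)) (f : (Fin n → Fin 2) → ℝ) : Prop :=
  ∀ (ψ : Ket (Fin n)) x, (c.matrix *ᵥ ψ) x = Complex.exp (f x * Complex.I) * ψ x

theorem extend_comp_self {ι κ : Type} (f : ι ↪ κ) (y : κ → Fin 2) :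
    Function.extend f (y ∘ f) y = y := by
  funext j
  by_cases hj : ∃ i, f i = j
  · obtain ⟨i, rfl⟩ := hj
    rw [f.injective.extend_apply]; rfl
  · rw [Function.extend_apply' _ _ _ hj]

theorem ActsAsPhase.relabel {m n : ℕ} {c : Circuit (Fin m)} {f : (Fin m → Fin 2) → ℝ}
    (h : ActsAsPhase c f) (e : Fin m ↪ Fin n) :
    ActsAsPhase (c.relabel e) fun x => f (x ∘ e) := by
  intro ψ x
  rw [Circuit.relabel_mulVec, h, extend_comp_self]

theorem ActsAsPhase.append {n : ℕ} {c d : Circuit (Fin n)} {f g h : (Fin n → Fin 2) → ℝ}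
    (hc : ActsAsPhase c f) (hd : ActsAsPhase d g) (hh : ∀ x, f x + g x = h x) :
    ActsAsPhase (c ++ d) h := by
  intro ψ x
  rw [Circuit.append_mulVec, hd, hc, ← mul_assoc, ← Complex.exp_add, ← hh]
  push_cast
  ring_nf

theorem exp_ofReal_mul_I_mul_conj (t : ℝ) :
    Complex.exp (t * Complex.I) * (starRingEnd ℂ) (Complex.exp (t * Complex.I)) = 1 := by
  rw [Complex.mul_conj, Complex.normSq_eq_norm_sq, Complex.norm_exp_ofReal_mul_I]
  simp

/-- On one qubit every diagonal unitary is a gate, so no global phase is lost. -/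
theorem exists_phase_one (f : (Fin 1 → Fin 2) → ℝ) : ∃ c : Circuit (Fin 1), c.IsLNN ∧ c.size = 1 ∧
    ActsAsPhase c f := by
  have hu : Matrix.diagonal (fun b : Fin 2 => Complex.exp (f (fun _ => b) * Complex.I)) ∈
      Matrix.unitaryGroup (Fin 2) ℂ := by
    rw [Matrix.mem_unitaryGroup_iff, Matrix.star_eq_conjTranspose, Matrix.diagonal_conjTranspose,
      Matrix.diagonal_mul_diagonal, ← Matrix.diagonal_one]
    congr 1
    funext b
    exact exp_ofReal_mul_I_mul_conj _
  refine ⟨[.single 0 ⟨_, hu⟩], Circuit.isLNN_singleton trivial, rfl, ?_⟩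
  intro ψ x
  have hx : (fun _ => x 0) = x := by funext j; rw [Subsingleton.elim j 0]
  rw [Circuit.cons_mulVec, Circuit.nil_mulVec, Gate.single_mulVec,
    Finset.sum_eq_single (x 0)]
  · simp [hx]
  · intro b _ hb
    simp [Matrix.diagonal_apply_ne _ hb.symm]
  · simp

/-- The bit string with the last bit flipped. -/
def flipLast {l : ℕ} (x : Fin (l + 1) → Fin 2) : Fin (l + 1) → Fin 2 :=
  Function.update x (Fin.last l) (x (Fin.last l) + 1)

/-- Multiplexed `z`-rotations: a phase that is odd under a flip of the last qubit. The phase is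
split into its even and odd parts under a flip of the first qubit, the control that is farthest
away. Both parts are multiplexed rotations with one control less, and the sign of the odd one comes from
conjugation by a CNOT. The long CNOTs occur least often, so the total stays linear in `2 ^ l`. The
summand `8 * l + 10` strengthens the bound so that it absorbs, in the induction, the two CNOTs of at most
`4 * l + 1` gates each. -/
theorem exists_phase_of_odd (l : ℕ) (f : (Fin (l + 1) → Fin 2) → ℝ)
    (hf : ∀ x, f (flipLast x) = -f x) : ∃ c : Circuit (Fin (l + 1)), c.IsLNN ∧
      c.size + (8 * l + 10) ≤ 11 * 2 ^ l ∧ ActsAsPhase c f := by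
  induction l with
  | zero =>
    obtain ⟨c, h1, h2, h3⟩ := exists_phase_one f
    exact ⟨c, h1, by rw [h2]; norm_num, h3⟩
  | succ l ih =>
    let s : (Fin (l + 1) → Fin 2) → ℝ := fun y => (f (Fin.cons 0 y) + f (Fin.cons 1 y)) / 2
    let d : (Fin (l + 1) → Fin 2) → ℝ := fun y => (f (Fin.cons 0 y) - f (Fin.cons 1 y)) / 2
    have hflip : ∀ (b : Fin 2) (y : Fin (l + 1) → Fin 2),
        f (Fin.cons b (flipLast y)) = - f (Fin.cons b y) := by
      intro b y
      rw [← hf]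
      congr 1
      rw [flipLast, flipLast, Fin.cons_update]
      rfl
    have hs : ∀ y, s (flipLast y) = - s y := by
      intro y; simp only [s, hflip]; ring
    have hd : ∀ y, d (flipLast y) = - d y := by
      intro y; simp only [d, hflip]; ring
    obtain ⟨cs, hs1, hs2, hs3⟩ := ih s hs
    obtain ⟨cd, hd1, hd2, hd3⟩ := ih d hd
    obtain ⟨t, ht1, ht2, ht3⟩ := exists_longCnot l
    have hl0 : (0 : Fin (l + 2)) ≠ Fin.last _ := by simp [Fin.ext_iff]
    refine ⟨cs.relabel (Fin.succEmb _) ++ (t ++ (cd.relabel (Fin.succEmb _) ++ t)),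
      Circuit.isLNN_append (Circuit.relabel_isLNN hs1 _ 1 fun i => rfl) (Circuit.isLNN_append ht1
        (Circuit.isLNN_append (Circuit.relabel_isLNN hd1 _ 1 fun i => rfl) ht1)), ?_, ?_⟩
    · simp only [Circuit.size_append, Circuit.size_relabel, pow_succ]
      omega
    · intro ψ x
      rw [Circuit.append_mulVec, Circuit.append_mulVec, Circuit.append_mulVec, ht3,
        hd3.relabel (Fin.succEmb _), ht3, hs3.relabel (Fin.succEmb _),
        update_cnot_involutive _ _ hl0, ← mul_assoc, ← Complex.exp_add]
      congr 2
      rw [← add_mul]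
      congr 1
      rw [← Complex.ofReal_add]
      congr 1
      have htail : Function.update x (Fin.last (l + 1)) (x (Fin.last (l + 1)) + x 0) ∘
          Fin.succEmb (l + 1) = Function.update (Fin.tail x) (Fin.last l)
            (Fin.tail x (Fin.last l) + x 0) := by
        exact Fin.tail_update_succ x (Fin.last l) _
      have htail' : x ∘ Fin.succEmb (l + 1) = Fin.tail x := rfl
      change d _ + s _ = _
      rw [htail, htail']
      have hx := Fin.cons_self_tail x
      generalize Fin.tail x = y at hx ⊢
      generalize x 0 = b at hx ⊢
      rw [← hx]
      fin_cases b
      · simp only [Fin.zero_eta, add_zero, Function.update_eq_self, s, d]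
        ring
      · simp only [Fin.mk_one]
        change d (flipLast y) + s y = _
        rw [hd]
        simp only [s, d]
        ring

theorem flipLast_snoc {l : ℕ} (x : Fin l → Fin 2) (b : Fin 2) :
    flipLast (Fin.snoc x b : Fin (l + 1) → Fin 2) = Fin.snoc x (b + 1) := by
  rw [flipLast, Fin.snoc_last, Fin.update_snoc_last]

/-- Every diagonal unitary on `l + 1` qubits on a line takes `O(2 ^ l)` gates: the part of the phase
that is even under a flip of the last qubit concerns one qubit less, the odd part is a multiplexed
rotation. -/
theorem exists_phase (l : ℕ) (f : (Fin (l + 1) → Fin 2) → ℝ) : ∃ c : Circuit (Fin (l + 1)),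
    c.IsLNN ∧ c.size ≤ 22 * 2 ^ l ∧ ActsAsPhase c f := by
  induction l with
  | zero =>
    obtain ⟨c, h1, h2, h3⟩ := exists_phase_one f
    exact ⟨c, h1, by rw [h2]; norm_num, h3⟩
  | succ l ih =>
    let g : (Fin (l + 1) → Fin 2) → ℝ := fun y =>
      (f (Fin.snoc y 0 : Fin (l + 2) → Fin 2) + f (Fin.snoc y 1 : Fin (l + 2) → Fin 2)) / 2
    let h : (Fin (l + 2) → Fin 2) → ℝ := fun x => f x - g (x ∘ Fin.castSuccEmb)
    have hh : ∀ x, h (flipLast x) = - h x := by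
      intro x
      rw [← Fin.snoc_init_self x, flipLast_snoc]
      have e : ∀ b : Fin 2, (Fin.snoc (Fin.init x) b : Fin (l + 2) → Fin 2) ∘ Fin.castSuccEmb =
          Fin.init x := by
        intro b; funext j; simp
      simp only [h, e]
      generalize x (Fin.last (l + 1)) = b
      fin_cases b <;> simp [g] <;> ring
    obtain ⟨c1, h1, h2, h3⟩ := ih g
    obtain ⟨c2, k1, k2, k3⟩ := exists_phase_of_odd _ h hh
    refine ⟨c1.relabel Fin.castSuccEmb ++ c2, Circuit.isLNN_append
      (Circuit.relabel_isLNN h1 _ 0 fun i => rfl) k1, ?_, (h3.relabel _).append k3 ?_⟩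
    · rw [Circuit.size_append, Circuit.size_relabel]
      rw [pow_succ] at k2 ⊢
      omega
    · intro x; simp [h]

/-! ### Preparation of states -/

theorem inv_sqrt_two_mul_self : (Real.sqrt 2 : ℂ)⁻¹ * (Real.sqrt 2 : ℂ)⁻¹ = 1 / 2 := by
  rw [← mul_inv, ← Complex.ofReal_mul, Real.mul_self_sqrt (by norm_num)]
  norm_num

/-- The Hadamard gate. -/
def hadamard : Matrix.unitaryGroup (Fin 2) ℂ :=
  ⟨!![1 / (Real.sqrt 2 : ℂ), 1 / (Real.sqrt 2 : ℂ); 1 / (Real.sqrt 2 : ℂ), -(1 / (Real.sqrt 2 : ℂ))], by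
    have h := inv_sqrt_two_mul_self
    rw [Matrix.mem_unitaryGroup_iff]
    ext i j
    fin_cases i <;> fin_cases j <;>
      simp [Matrix.mul_apply, Matrix.star_apply, h] <;> norm_num⟩

theorem extend_castSucc_snoc {l : ℕ} (z a : Fin l → Fin 2) (b : Fin 2) :
    Function.extend (Fin.castSuccEmb : Fin l ↪ Fin (l + 1)) z (Fin.snoc a b : Fin (l + 1) → Fin 2) =
      Fin.snoc z b := by
  funext j
  refine Fin.lastCases ?_ (fun i => ?_) j
  · rw [Function.extend_apply', Fin.snoc_last, Fin.snoc_last]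
    rintro ⟨i, hi⟩
    exact Fin.castSucc_ne_last i hi
  · rw [Fin.snoc_castSucc]
    exact (Fin.castSuccEmb : Fin l ↪ Fin (l + 1)).injective.extend_apply z _ i

theorem single_last_mulVec {l : ℕ} (u : Matrix.unitaryGroup (Fin 2) ℂ) (ψ : Ket (Fin (l + 1)))
    (a : Fin l → Fin 2) (b : Fin 2) :
    (Circuit.matrix [Gate.single (Fin.last l) u] *ᵥ ψ) (Fin.snoc a b : Fin (l + 1) → Fin 2) =
      (u : Matrix (Fin 2) (Fin 2) ℂ) b 0 * ψ (Fin.snoc a 0 : Fin (l + 1) → Fin 2) +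
      (u : Matrix (Fin 2) (Fin 2) ℂ) b 1 * ψ (Fin.snoc a 1 : Fin (l + 1) → Fin 2) := by
  rw [Circuit.cons_mulVec, Circuit.nil_mulVec, Gate.single_mulVec, Fin.sum_univ_two]
  simp only [Fin.snoc_last, Fin.update_snoc_last]

/-- To prepare a state of `l + 1` qubits, prepare the norms of its components along the first `l`
qubits, and turn the last qubit to the normalized component; `H · diag (e^{iθ}, e^{-iθ}) · H` rotates
`|0⟩` to `cos θ |0⟩ + i sin θ |1⟩`, and a final diagonal unitary corrects the phases. -/
theorem exists_prepares_snoc {l : ℕ} (u : Ket (Fin (l + 1))) (c : Circuit (Fin l)) (hc : c.IsLNN)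
    (hp : c.Prepares fun a => ((Real.sqrt (‖u (Fin.snoc a 0 : Fin (l + 1) → Fin 2)‖ ^ 2 +
      ‖u (Fin.snoc a 1 : Fin (l + 1) → Fin 2)‖ ^ 2) : ℝ) : ℂ)) :
    ∃ c' : Circuit (Fin (l + 1)), c'.IsLNN ∧ c'.size ≤ c.size + 46 * 2 ^ l ∧ c'.Prepares u := by
  let z : (Fin l → Fin 2) → ℂ := fun a =>
    ⟨‖u (Fin.snoc a 0 : Fin (l + 1) → Fin 2)‖, ‖u (Fin.snoc a 1 : Fin (l + 1) → Fin 2)‖⟩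
  have hz : ∀ a, Real.sqrt (‖u (Fin.snoc a 0 : Fin (l + 1) → Fin 2)‖ ^ 2 +
      ‖u (Fin.snoc a 1 : Fin (l + 1) → Fin 2)‖ ^ 2) = ‖z a‖ := by
    intro a
    rw [Complex.norm_def (z a), Complex.normSq_mk, sq, sq]
  let f₁ : (Fin (l + 1) → Fin 2) → ℝ := fun x =>
    if x (Fin.last l) = 0 then (z (Fin.init x)).arg else -(z (Fin.init x)).arg
  let f₂ : (Fin (l + 1) → Fin 2) → ℝ := fun x =>
    if x (Fin.last l) = 0 then (u x).arg else (u x).arg - Real.pi / 2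
  obtain ⟨d₁, h1, h2, h3⟩ := exists_phase l f₁
  obtain ⟨d₂, k1, k2, k3⟩ := exists_phase l f₂
  have hH : Circuit.IsLNN [Gate.single (Fin.last l) hadamard] := Circuit.isLNN_singleton trivial
  refine ⟨c.relabel Fin.castSuccEmb ++ ([.single (Fin.last l) hadamard] ++ (d₁ ++
    ([.single (Fin.last l) hadamard] ++ d₂))), Circuit.isLNN_append
      (Circuit.relabel_isLNN hc _ 0 fun i => rfl) (Circuit.isLNN_append hH (Circuit.isLNN_append h1
        (Circuit.isLNN_append hH k1))), ?_, ?_⟩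
  · have h4 : 1 ≤ 2 ^ l := Nat.one_le_two_pow
    simp only [Circuit.size_append, Circuit.size_relabel]
    have h5 : Circuit.size [Gate.single (Fin.last l) hadamard] = 1 := rfl
    omega
  · unfold Circuit.Prepares at hp ⊢
    simp only [Circuit.append_mulVec]
    set S1 := Circuit.matrix (c.relabel Fin.castSuccEmb) *ᵥ ket (0 : Fin (l + 1) → Fin 2) with hS1
    have e1 : ∀ a b, S1 (Fin.snoc a b : Fin (l + 1) → Fin 2) = if b = 0 then (‖z a‖ : ℂ) else 0 := by
      intro a b
      rw [hS1, Circuit.relabel_mulVec]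
      simp only [extend_castSucc_snoc]
      have e : (Fin.snoc a b : Fin (l + 1) → Fin 2) ∘ (Fin.castSuccEmb : Fin l ↪ Fin (l + 1)) = a := by
        funext j; simp
      rw [e]
      by_cases hb : b = 0
      · subst hb
        have e' : (fun w : Fin l → Fin 2 => ket (0 : Fin (l + 1) → Fin 2)
            (Fin.snoc w 0 : Fin (l + 1) → Fin 2)) = ket 0 := by
          funext w
          rw [ket_apply, ket_apply]
          congr 1
          rw [eq_iff_iff]
          constructor
          · intro h
            funext j
            have := congrFun h j.castSucc
            rwa [Fin.snoc_castSucc] at this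
          · rintro rfl
            funext j
            refine Fin.lastCases ?_ (fun i => ?_) j <;> simp
        rw [e', hp, if_pos rfl, ← hz]
      · have e' : (fun w : Fin l → Fin 2 => ket (0 : Fin (l + 1) → Fin 2)
            (Fin.snoc w b : Fin (l + 1) → Fin 2)) = 0 := by
          funext w
          rw [ket_apply, if_neg]
          · rfl
          · intro h
            have := congrFun h (Fin.last l)
            rw [Fin.snoc_last] at this
            exact hb this
        rw [e', Matrix.mulVec_zero, if_neg hb]
        rfl
    set S2 := Circuit.matrix [Gate.single (Fin.last l) hadamard] *ᵥ S1 with hS2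
    have e2 : ∀ a b, S2 (Fin.snoc a b : Fin (l + 1) → Fin 2) = (Real.sqrt 2 : ℂ)⁻¹ * ‖z a‖ := by
      intro a b
      rw [hS2, single_last_mulVec, e1, e1]
      fin_cases b <;> simp [hadamard]
    have hcs : ∀ a, (‖z a‖ : ℂ) * Complex.cos ((z a).arg) =
        ‖u (Fin.snoc a 0 : Fin (l + 1) → Fin 2)‖ := by
      intro a
      rw [← Complex.ofReal_cos, ← Complex.ofReal_mul, Complex.norm_mul_cos_arg]
    have hsn : ∀ a, (‖z a‖ : ℂ) * Complex.sin ((z a).arg) =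
        ‖u (Fin.snoc a 1 : Fin (l + 1) → Fin 2)‖ := by
      intro a
      rw [← Complex.ofReal_sin, ← Complex.ofReal_mul, Complex.norm_mul_sin_arg]
    have e3 : ∀ a, (Circuit.matrix d₁ *ᵥ S2) (Fin.snoc a 0 : Fin (l + 1) → Fin 2) =
        (Real.sqrt 2 : ℂ)⁻¹ * (‖u (Fin.snoc a 0 : Fin (l + 1) → Fin 2)‖ +
          ‖u (Fin.snoc a 1 : Fin (l + 1) → Fin 2)‖ * Complex.I) := by
      intro a
      rw [h3, e2, ← hcs, ← hsn]
      simp only [f₁, Fin.snoc_last, if_true, Fin.init_snoc, Complex.exp_mul_I]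
      ring
    have e4 : ∀ a, (Circuit.matrix d₁ *ᵥ S2) (Fin.snoc a 1 : Fin (l + 1) → Fin 2) =
        (Real.sqrt 2 : ℂ)⁻¹ * (‖u (Fin.snoc a 0 : Fin (l + 1) → Fin 2)‖ -
          ‖u (Fin.snoc a 1 : Fin (l + 1) → Fin 2)‖ * Complex.I) := by
      intro a
      rw [h3, e2, ← hcs, ← hsn]
      simp only [f₁, Fin.snoc_last, one_ne_zero, if_false, Fin.init_snoc, Complex.ofReal_neg,
        Complex.exp_mul_I, Complex.cos_neg, Complex.sin_neg]
      ring
    funext x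
    rw [k3, ← Fin.snoc_init_self x, single_last_mulVec, e3, e4]
    generalize Fin.init x = a
    generalize x (Fin.last l) = b
    have hsq := inv_sqrt_two_mul_self
    fin_cases b
    · simp only [f₂, hadamard, Fin.zero_eta, Fin.snoc_last, if_true]
      simp only [Matrix.of_apply, Matrix.cons_val', Matrix.cons_val_zero, Matrix.cons_val_one,
        Matrix.cons_val_fin_one]
      conv_rhs => rw [← Complex.norm_mul_exp_arg_mul_I (u (Fin.snoc a 0 : Fin (l + 1) → Fin 2))]
      linear_combination (2 * Complex.exp ((u (Fin.snoc a 0 : Fin (l + 1) → Fin 2)).arg * Complex.I) *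
        ‖u (Fin.snoc a 0 : Fin (l + 1) → Fin 2)‖) * hsq
    · simp only [f₂, hadamard, Fin.mk_one, Fin.snoc_last, one_ne_zero, if_false]
      simp only [Matrix.of_apply, Matrix.cons_val', Matrix.cons_val_zero, Matrix.cons_val_one,
        Matrix.cons_val_fin_one]
      have he : Complex.exp ((((u (Fin.snoc a 1 : Fin (l + 1) → Fin 2)).arg - Real.pi / 2 : ℝ) : ℂ) *
          Complex.I) = Complex.exp ((u (Fin.snoc a 1 : Fin (l + 1) → Fin 2)).arg * Complex.I) *
            (-Complex.I) := by
        rw [Complex.ofReal_sub, sub_mul, Complex.exp_sub]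
        push_cast
        rw [Complex.exp_pi_div_two_mul_I, div_eq_mul_inv, Complex.inv_I]
      rw [he]
      conv_rhs => rw [← Complex.norm_mul_exp_arg_mul_I (u (Fin.snoc a 1 : Fin (l + 1) → Fin 2))]
      linear_combination (-2 * Complex.I ^ 2 *
        Complex.exp ((u (Fin.snoc a 1 : Fin (l + 1) → Fin 2)).arg * Complex.I) *
        ‖u (Fin.snoc a 1 : Fin (l + 1) → Fin 2)‖) * hsq -
        (Complex.exp ((u (Fin.snoc a 1 : Fin (l + 1) → Fin 2)).arg * Complex.I) *
        ‖u (Fin.snoc a 1 : Fin (l + 1) → Fin 2)‖) * Complex.I_sq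

theorem sum_snoc {M : Type*} [AddCommMonoid M] {l : ℕ} (f : (Fin (l + 1) → Fin 2) → M) :
    ∑ x, f x = ∑ a : Fin l → Fin 2, ∑ b : Fin 2, f (Fin.snoc a b : Fin (l + 1) → Fin 2) := by
  rw [← (Fin.snocEquiv (fun _ : Fin (l + 1) => Fin 2)).sum_comp, Fintype.sum_prod_type,
    Finset.sum_comm]
  rfl

theorem sum_cons {M : Type*} [AddCommMonoid M] {l : ℕ} (f : (Fin (l + 1) → Fin 2) → M) :
    ∑ x, f x = ∑ b : Fin 2, ∑ a : Fin l → Fin 2, f (Fin.cons b a : Fin (l + 1) → Fin 2) := by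
  rw [← (Fin.consEquiv (fun _ : Fin (l + 1) => Fin 2)).sum_comp, Fintype.sum_prod_type]
  rfl

/-- Induction on the number of qubits with `exists_prepares_snoc`, starting from the empty register,
where the norm of a unit vector is the state itself. -/
theorem exists_prepares (l : ℕ) (u : Ket (Fin (l + 1))) (hu : ∑ x, ‖u x‖ ^ 2 = 1) :
    ∃ c : Circuit (Fin (l + 1)), c.IsLNN ∧ c.size ≤ 92 * 2 ^ l ∧ c.Prepares u := by
  have key : ∀ {l : ℕ} (u : Ket (Fin (l + 1))), ∑ x, ‖u x‖ ^ 2 = 1 →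
      ∑ a : Fin l → Fin 2, ‖((Real.sqrt (‖u (Fin.snoc a 0 : Fin (l + 1) → Fin 2)‖ ^ 2 +
        ‖u (Fin.snoc a 1 : Fin (l + 1) → Fin 2)‖ ^ 2) : ℝ) : ℂ)‖ ^ 2 = 1 := by
    intro l u hu
    rw [← hu, sum_snoc]
    refine Finset.sum_congr rfl fun a _ => ?_
    rw [Fin.sum_univ_two, Complex.norm_real, Real.norm_eq_abs, sq_abs, Real.sq_sqrt (by positivity)]
  induction l with
  | zero =>
    obtain ⟨c, h1, h2, h3⟩ := exists_prepares_snoc u [] Circuit.isLNN_nil (by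
      have h := key u hu
      unfold Circuit.Prepares
      rw [Circuit.nil_mulVec]
      funext a
      rw [Fintype.sum_unique, Complex.norm_real, Real.norm_eq_abs, sq_abs] at h
      have h' := (pow_eq_one_iff_of_nonneg (Real.sqrt_nonneg _) two_ne_zero).1 h
      rw [Unique.eq_default a, h', ket_apply, if_pos (Subsingleton.elim _ _)]
      simp)
    exact ⟨c, h1, h2.trans (by simp [Circuit.size]), h3⟩
  | succ l ih =>
    obtain ⟨c, h1, h2, h3⟩ := ih _ (key u hu)
    obtain ⟨c', k1, k2, k3⟩ := exists_prepares_snoc u c h1 h3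
    refine ⟨c', k1, ?_, k3⟩
    rw [pow_succ] at k2 ⊢
    omega

/-! ### Reflections and isometries -/

/-- The phase `φ` on the basis vector `|0…0⟩` alone. -/
theorem exists_phase_ket (l : ℕ) (φ : ℝ) : ∃ c : Circuit (Fin (l + 1)), c.IsLNN ∧
    c.size ≤ 22 * 2 ^ l ∧ ∀ ψ : Ket (Fin (l + 1)),
      c.matrix *ᵥ ψ = ψ + ((Complex.exp (φ * Complex.I) - 1) * ψ 0) • ket 0 := by
  obtain ⟨c, h1, h2, h3⟩ := exists_phase l fun x => if x = 0 then φ else 0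
  refine ⟨c, h1, h2, fun ψ => ?_⟩
  funext x
  rw [h3, Pi.add_apply, Pi.smul_apply, ket_apply]
  by_cases hx : x = 0
  · subst hx
    simp only [if_true, smul_eq_mul]
    ring
  · simp [hx]

/-- A complex Householder reflection: for unit vectors `v ≠ w` there is a unitary that takes `v`
to `w` and is the identity on the orthogonal complement of `v - w`. It multiplies `v - w` by the phase
`-conj a / a`, where `a = ⟨v - w, v⟩`; the real part of `a` is half the squared norm of `v - w`. -/
theorem exists_reflection (l : ℕ) (v w : Ket (Fin (l + 1))) (hv : star v ⬝ᵥ v = 1)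
    (hw : star w ⬝ᵥ w = 1) : ∃ c : Circuit (Fin (l + 1)), c.IsLNN ∧ c.size ≤ 206 * 2 ^ l ∧
      c.matrix *ᵥ v = w ∧ ∀ e, star (v - w) ⬝ᵥ e = 0 → c.matrix *ᵥ e = e := by
  by_cases hvw : v = w
  · exact ⟨[], Circuit.isLNN_nil, Nat.zero_le _, by rw [Circuit.nil_mulVec, hvw],
      fun e _ => Circuit.nil_mulVec e⟩
  have hne : v - w ≠ 0 := sub_ne_zero.2 hvw
  set a : ℂ := star (v - w) ⬝ᵥ v with ha
  have hdot : star (v - w) ⬝ᵥ (v - w) = ((∑ x, ‖(v - w) x‖ ^ 2 : ℝ) : ℂ) := by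
    rw [dotProduct, Complex.ofReal_sum]
    refine Finset.sum_congr rfl fun x _ => ?_
    rw [Pi.star_apply, Complex.star_def, mul_comm, Complex.mul_conj, Complex.normSq_eq_norm_sq]
  set t : ℝ := ∑ x, ‖(v - w) x‖ ^ 2 with ht
  have htpos : 0 < t := by
    obtain ⟨x, hx⟩ := Function.ne_iff.1 hne
    refine Finset.sum_pos' (fun _ _ => by positivity) ⟨x, Finset.mem_univ _, ?_⟩
    have : 0 < ‖(v - w) x‖ := norm_pos_iff.2 hx
    positivity
  -- only here is it used that `v` and `w` have the same norm
  have haa : a + star a = t := by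
    have h1 : star a = 1 - star v ⬝ᵥ w := by
      rw [ha, Matrix.star_dotProduct, star_star, dotProduct_sub, hv]
    have h2 : a = 1 - star w ⬝ᵥ v := by
      rw [ha, star_sub, sub_dotProduct, hv]
    rw [h1, h2, ← hdot, star_sub, sub_dotProduct, dotProduct_sub, dotProduct_sub, hv, hw]
    ring
  have ha0 : a ≠ 0 := by
    intro h
    rw [h, star_zero, add_zero] at haa
    exact htpos.ne (by exact_mod_cast haa)
  set z : ℂ := -(star a) / a with hzdef
  have hz1 : ‖z‖ = 1 := by
    rw [hzdef, norm_div, norm_neg, norm_star, div_self (norm_ne_zero_iff.2 ha0)]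
  have hz : Complex.exp (z.arg * Complex.I) = z := by
    have := Complex.norm_mul_exp_arg_mul_I z
    rwa [hz1, Complex.ofReal_one, one_mul] at this
  set u : Ket (Fin (l + 1)) := ((Real.sqrt t : ℝ) : ℂ)⁻¹ • (v - w) with hu
  have hsq : ((Real.sqrt t : ℝ) : ℂ)⁻¹ * ((Real.sqrt t : ℝ) : ℂ)⁻¹ = (t : ℂ)⁻¹ := by
    rw [← mul_inv, ← Complex.ofReal_mul, Real.mul_self_sqrt htpos.le]
  have hu1 : ∑ x, ‖u x‖ ^ 2 = 1 := by
    have : ∀ x, ‖u x‖ ^ 2 = t⁻¹ * ‖(v - w) x‖ ^ 2 := by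
      intro x
      rw [hu, Pi.smul_apply, norm_smul, mul_pow, norm_inv, Complex.norm_real, Real.norm_eq_abs,
        inv_pow, sq_abs, Real.sq_sqrt htpos.le]
    simp only [this]
    rw [← Finset.mul_sum, ← ht, inv_mul_cancel₀ htpos.ne']
  obtain ⟨p, p1, p2, p3⟩ := exists_prepares l u hu1
  obtain ⟨d, d1, d2, d3⟩ := exists_phase_ket l z.arg
  have hact : ∀ e, Circuit.matrix (p.inv ++ (d ++ p)) *ᵥ e =
      e + ((z - 1) * (star u ⬝ᵥ e)) • u := by
    intro e
    have h0 : (p.matrixᴴ *ᵥ e) 0 = star u ⬝ᵥ e := by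
      rw [← star_ket_dotProduct 0 (p.matrixᴴ *ᵥ e), Matrix.dotProduct_mulVec, ← Matrix.star_mulVec]
      rw [show p.matrix *ᵥ ket 0 = u from p3]
    rw [Circuit.append_mulVec, Circuit.append_mulVec, Circuit.inv_matrix, d3, Matrix.mulVec_add,
      Matrix.mulVec_smul, Matrix.mulVec_mulVec, p.mul_conjTranspose_matrix, Matrix.one_mulVec, h0,
      hz, show p.matrix *ᵥ ket 0 = u from p3]
  have hue : ∀ e, (star u ⬝ᵥ e) • u = ((t : ℂ)⁻¹ * (star (v - w) ⬝ᵥ e)) • (v - w) := by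
    intro e
    rw [hu, star_smul, smul_dotProduct, smul_smul, ← hsq]
    congr 1
    simp only [smul_eq_mul, star_inv₀, Complex.star_def, Complex.conj_ofReal]
    ring
  refine ⟨p.inv ++ (d ++ p), Circuit.isLNN_append (Circuit.inv_isLNN p1)
    (Circuit.isLNN_append d1 p1), ?_, ?_, ?_⟩
  · simp only [Circuit.size_append, Circuit.inv_size]
    omega
  · rw [hact, mul_smul, hue, smul_smul, ← ha]
    have : (z - 1) * ((t : ℂ)⁻¹ * a) = -1 := by
      have ht0 : (t : ℂ) ≠ 0 := by exact_mod_cast htpos.ne'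
      rw [hzdef]
      field_simp
      rw [← haa]
      ring
    rw [this, neg_one_smul]
    abel
  · intro e he
    rw [hact, mul_smul, hue, he, mul_zero, zero_smul, smul_zero, add_zero]

/-- Any orthonormal family is reached from basis vectors, one Householder reflection for each. -/
theorem exists_circuit_of_orthonormal (l : ℕ) (v : (Fin (l + 1) → Fin 2) → Ket (Fin (l + 1)))
    (S : Finset (Fin (l + 1) → Fin 2))
    (hS : ∀ s ∈ S, ∀ t ∈ S, star (v s) ⬝ᵥ v t = if s = t then 1 else 0) :
    ∃ c : Circuit (Fin (l + 1)), c.IsLNN ∧ c.size ≤ S.card * (206 * 2 ^ l) ∧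
      ∀ s ∈ S, c.matrix *ᵥ ket s = v s := by
  induction S using Finset.induction_on with
  | empty => exact ⟨[], Circuit.isLNN_nil, Nat.zero_le _, by simp⟩
  | insert s S hs ih =>
    obtain ⟨c, h1, h2, h3⟩ := ih fun a ha b hb =>
      hS a (Finset.mem_insert_of_mem ha) b (Finset.mem_insert_of_mem hb)
    set w : Ket (Fin (l + 1)) := c.matrixᴴ *ᵥ v s with hwdef
    have hcw : c.matrix *ᵥ w = v s := by
      rw [hwdef, Matrix.mulVec_mulVec, c.mul_conjTranspose_matrix, Matrix.one_mulVec]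
    have hw : star w ⬝ᵥ w = 1 := by
      rw [← c.star_mulVec_dotProduct, hcw, hS s (Finset.mem_insert_self _ _) s
        (Finset.mem_insert_self _ _), if_pos rfl]
    have hk : star (ket s) ⬝ᵥ (ket s : Ket (Fin (l + 1))) = 1 := by
      rw [star_ket_dotProduct, ket_apply, if_pos rfl]
    -- `w` is orthogonal to the basis vectors already treated, so the reflection fixes them
    obtain ⟨r, r1, r2, r3, r4⟩ := exists_reflection l (ket s) w hk hw
    refine ⟨r ++ c, Circuit.isLNN_append r1 h1, ?_, ?_⟩
    · rw [Circuit.size_append, Finset.card_insert_of_notMem hs, add_mul, one_mul]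
      omega
    · intro t ht
      rw [Circuit.append_mulVec]
      rcases Finset.mem_insert.1 ht with rfl | ht'
      · rw [r3, hcw]
      · have hst : s ≠ t := by rintro rfl; exact hs ht'
        rw [r4, h3 t ht']
        rw [star_sub, sub_dotProduct, star_ket_dotProduct, ket_apply, if_neg hst,
          ← c.star_mulVec_dotProduct, hcw, h3 t ht', hS s (Finset.mem_insert_self _ _) t ht,
          if_neg hst, sub_zero]

theorem padZeros_injective {k n : ℕ} (h : k ≤ n) :
    Function.Injective (padZeros n : (Fin k → Fin 2) → Fin n → Fin 2) := by
  intro a b hab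
  funext i
  have := congrFun hab ⟨i, i.2.trans_le h⟩
  simpa [padZeros] using this

/-- An isometry from `k` to `n` qubits takes `O(2 ^ (k + n))` gates on a line. -/
theorem exists_isometry_circuit {n k : ℕ} (V : Matrix (Fin n → Fin 2) (Fin k → Fin 2) ℂ)
    (hn : 0 < n) (hkn : k ≤ n) (hV : Vᴴ * V = 1) :
    ∃ c : Circuit (Fin n), c.IsLNN ∧ c.size ≤ 103 * 2 ^ (n + k) ∧
      ∀ a, c.matrix *ᵥ ket (padZeros n a) = fun x => V x a := by
  obtain ⟨l, rfl⟩ := Nat.exists_eq_add_one.2 hn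
  have hinj := padZeros_injective hkn
  have hval : ∀ a, Function.extend (padZeros (l + 1)) (fun a => fun x => V x a)
      (fun _ => 0) (padZeros (l + 1) a) = fun x => V x a := fun a => hinj.extend_apply _ _ a
  obtain ⟨c, h1, h2, h3⟩ := exists_circuit_of_orthonormal l
    (Function.extend (padZeros (l + 1)) (fun a => fun x => V x a) (fun _ => 0))
    (Finset.univ.image (padZeros (l + 1))) (by
      intro s hs t ht
      obtain ⟨a, -, rfl⟩ := Finset.mem_image.1 hs
      obtain ⟨b, -, rfl⟩ := Finset.mem_image.1 ht
      rw [hval, hval]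
      have := congrFun (congrFun hV a) b
      rw [Matrix.mul_apply, Matrix.one_apply] at this
      simp only [hinj.eq_iff]
      rw [← this]
      rfl)
  refine ⟨c, h1, h2.trans ?_, fun a => ?_⟩
  · rw [Finset.card_image_of_injective _ hinj, Finset.card_univ, Fintype.card_fun, Fintype.card_fin,
      Fintype.card_fin]
    apply le_of_eq
    ring
  · rw [h3 _ (Finset.mem_image_of_mem _ (Finset.mem_univ a)), hval]

open Classical in
/-- A synthesis method that realizes every isometry with `O(2 ^ (n + k))` nearest-neighbour gates. -/
def lnnSynthesis : IsometrySynthesis where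
  circuit {n k} V := if h : 0 < n ∧ k ≤ n ∧ Vᴴ * V = 1 then
    (exists_isometry_circuit V h.1 h.2.1 h.2.2).choose else []
  correct {n k} V hn hkn hV a := by
    rw [dif_pos ⟨hn, hkn, hV⟩]
    exact (exists_isometry_circuit V hn hkn hV).choose_spec.2.2 a

theorem lnnSynthesis_isLNN {n k : ℕ} (V : Matrix (Fin n → Fin 2) (Fin k → Fin 2) ℂ) :
    (lnnSynthesis.circuit V).IsLNN := by
  simp only [lnnSynthesis]
  split_ifs with h
  exacts [(exists_isometry_circuit V h.1 h.2.1 h.2.2).choose_spec.1, Circuit.isLNN_nil]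

theorem lnnSynthesis_size {n k : ℕ} (V : Matrix (Fin n → Fin 2) (Fin k → Fin 2) ℂ) :
    (lnnSynthesis.circuit V).size ≤ 103 * 2 ^ (n + k) := by
  simp only [lnnSynthesis]
  split_ifs with h
  exacts [(exists_isometry_circuit V h.1 h.2.1 h.2.2).choose_spec.2.1, Nat.zero_le _]

/-! ### Compact singular value decompositions and sweeps -/

open scoped ComplexOrder in
/-- The right singular vectors are the eigenvectors of `Mᴴ M` for positive eigenvalues; `M` maps them
to orthogonal vectors and annihilates the other eigenvectors. -/
theorem exists_isCompactSVD {m n : Type} [Fintype m] [Fintype n] (M : Matrix m n ℂ) :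
    ∃ (r : ℕ) (U : Matrix m (Fin r) ℂ) (s : Fin r → ℝ) (V : Matrix n (Fin r) ℂ),
      IsCompactSVD M U s V := by
  classical
  have hA : (Mᴴ * M).PosSemidef := Matrix.posSemidef_conjTranspose_mul_self M
  set lam := hA.isHermitian.eigenvalues with hlam
  have hlam0 : ∀ i, 0 ≤ lam i := hA.eigenvalues_nonneg
  set W : Matrix n n ℂ := hA.isHermitian.eigenvectorUnitary.1 with hW
  have hW1 : Wᴴ * W = 1 := Matrix.mem_unitaryGroup_iff'.1 hA.isHermitian.eigenvectorUnitary.2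
  have hW2 : W * Wᴴ = 1 := Matrix.mem_unitaryGroup_iff.1 hA.isHermitian.eigenvectorUnitary.2
  set G : Matrix m n ℂ := M * W with hG
  have hGG : Gᴴ * G = Matrix.diagonal fun i => (lam i : ℂ) := by
    have h : Mᴴ * M = W * Matrix.diagonal (fun i => (lam i : ℂ)) * Wᴴ := by
      have := hA.isHermitian.spectral_theorem
      rw [Unitary.conjStarAlgAut_apply] at this
      exact this
    rw [hG, Matrix.conjTranspose_mul, Matrix.mul_assoc, ← Matrix.mul_assoc Mᴴ, h]
    simp only [Matrix.mul_assoc, hW1, Matrix.mul_one]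
    rw [← Matrix.mul_assoc, hW1, Matrix.one_mul]
  have hGG' : ∀ i j, ∑ k, star (G k i) * G k j = if i = j then (lam i : ℂ) else 0 := by
    intro i j
    have := congrFun (congrFun hGG i) j
    rw [Matrix.diagonal_apply] at this
    exact this
  have hM : M = G * Wᴴ := by rw [hG, Matrix.mul_assoc, hW2, Matrix.mul_one]
  have hzero : ∀ i, ¬ 0 < lam i → ∀ k, G k i = 0 := by
    intro i hi k
    have h0 : lam i = 0 := le_antisymm (not_lt.1 hi) (hlam0 i)
    have h1 : ∑ k, ‖G k i‖ ^ 2 = 0 := by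
      have := hGG' i i
      rw [if_pos rfl, h0, Complex.ofReal_zero] at this
      have h2 : ((∑ k, ‖G k i‖ ^ 2 : ℝ) : ℂ) = 0 := by
        rw [← this, Complex.ofReal_sum]
        refine Finset.sum_congr rfl fun k _ => ?_
        rw [Complex.star_def, mul_comm, Complex.mul_conj, Complex.normSq_eq_norm_sq]
      exact_mod_cast h2
    have := (Finset.sum_eq_zero_iff_of_nonneg fun k _ => by positivity).1 h1 k (Finset.mem_univ _)
    simpa using this
  let e := (Fintype.equivFin {i // 0 < lam i}).symm
  have hpos : ∀ j, 0 < Real.sqrt (lam (e j)) := fun j => Real.sqrt_pos.2 (e j).2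
  refine ⟨_, Matrix.of fun k j => G k (e j) * ((Real.sqrt (lam (e j)) : ℝ) : ℂ)⁻¹,
    fun j => Real.sqrt (lam (e j)), W.submatrix id fun j => (e j : n), hpos, ?_, ?_, ?_⟩
  · ext i j
    rw [Matrix.mul_apply]
    simp only [Matrix.conjTranspose_apply, Matrix.of_apply, star_mul']
    have h : ∀ k, star (G k (e i)) * star (((Real.sqrt (lam (e i)) : ℝ) : ℂ)⁻¹) *
        (G k (e j) * ((Real.sqrt (lam (e j)) : ℝ) : ℂ)⁻¹) =
        (star (G k (e i)) * G k (e j)) * (star (((Real.sqrt (lam (e i)) : ℝ) : ℂ)⁻¹) *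
          ((Real.sqrt (lam (e j)) : ℝ) : ℂ)⁻¹) := fun k => by ring
    simp only [h]
    rw [← Finset.sum_mul, hGG', Matrix.one_apply]
    by_cases hij : i = j
    · subst hij
      rw [if_pos rfl, if_pos rfl, star_inv₀, Complex.star_def, Complex.conj_ofReal, ← mul_inv,
        ← Complex.ofReal_mul, Real.mul_self_sqrt (hlam0 _), mul_inv_cancel₀]
      exact_mod_cast (e i).2.ne'
    · have : ¬ ((e i : n) = e j) := fun h => hij (e.injective (Subtype.ext h))
      rw [if_neg this, if_neg hij, zero_mul]
  · ext i j
    have := congrFun (congrFun hW1 (e i)) (e j)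
    rw [Matrix.one_apply] at this ⊢
    have h : ((e i : n) = e j) ↔ i = j := ⟨fun h => e.injective (Subtype.ext h), fun h => by rw [h]⟩
    simp only [h] at this
    rw [← this]
    rfl
  · ext k l
    rw [hM, Matrix.mul_apply, Matrix.mul_apply]
    simp only [Matrix.mul_diagonal, Matrix.of_apply, Matrix.conjTranspose_apply,
      Matrix.submatrix_apply, id]
    have h : ∀ j, G k (e j) * ((Real.sqrt (lam (e j)) : ℝ) : ℂ)⁻¹ * ((Real.sqrt (lam (e j)) : ℝ) : ℂ) =
        G k (e j) := by
      intro j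
      rw [mul_assoc, inv_mul_cancel₀, mul_one]
      exact_mod_cast (hpos j).ne'
    simp only [h]
    rw [e.sum_comp fun i => G k i * star (W l i)]
    symm
    refine Fintype.sum_of_injective (fun i : {i // 0 < lam i} => (i : n)) Subtype.val_injective _ _
      ?_ fun _ => rfl
    intro i hi
    rw [hzero i, zero_mul]
    intro h
    exact hi ⟨⟨i, h⟩, rfl⟩

/-- Dependent choice along `0, 1, 2, …`. -/
theorem exists_forward_chain {S : ℕ → Type*} (P : ∀ n, S n → S (n + 1) → Prop)
    (h : ∀ n a, ∃ b, P n a b) (s₀ : S 0) :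
    ∃ s : ∀ n, S n, s 0 = s₀ ∧ ∀ n, P n (s n) (s (n + 1)) := by
  choose f hf using h
  exact ⟨fun n => Nat.rec s₀ (fun n a => f n a) n, rfl, fun n => hf n _⟩

/-- Dependent choice along `N, N - 1, …, 0`. The induction shifts the family `S` instead of indexing it by
`N - k`, so no transport between its members is needed. -/
theorem exists_backward_chain (N : ℕ) : ∀ {S : ℕ → Type} [∀ n, Nonempty (S n)]
    (P : ∀ n, S n → S (n + 1) → Prop) (_ : ∀ n b, ∃ a, P n a b) (sN : S N),
    ∃ s : ∀ n, S n, s N = sN ∧ ∀ n, n < N → P n (s n) (s (n + 1)) := by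
  induction N with
  | zero =>
    intro S _ P h sN
    exact ⟨fun n => Nat.casesOn n sN fun n => Classical.arbitrary _, rfl,
      fun n hn => absurd hn (by omega)⟩
  | succ N ih =>
    intro S _ P h sN
    obtain ⟨s, h1, h2⟩ := ih (S := fun n => S (n + 1)) (fun n => P (n + 1)) (fun n => h (n + 1)) sN
    obtain ⟨a, ha⟩ := h 0 (s 0)
    refine ⟨fun n => Nat.casesOn n a s, h1, fun n hn => ?_⟩
    cases n with
    | zero => exact ha
    | succ n => exact h2 n (by omega)

theorem subsingleton_fin_of_eq_one {d : ℕ} (h : d = 1) : Subsingleton (Fin d) := by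
  subst h; infer_instance

theorem exists_sweepRight {N : ℕ} (M : MPS N) : ∃ B, SweepRight M B := by
  have step : ∀ n (a : Σ d, Matrix (Fin d) (Fin (M.D n)) ℂ),
      ∃ b : Σ d, Matrix (Fin d) (Fin (M.D (n + 1))) ℂ,
      ∃ T : Fin 2 → Matrix (Fin a.1) (Fin b.1) ℂ,
        (n + 1 < N → ∃ (s : Fin b.1 → ℝ) (V : Matrix (Fin (M.D (n + 1))) (Fin b.1) ℂ),
          IsCompactSVD (leftMat fun x => a.2 * M.A n x) (leftMat T) s V ∧
          b.2 = Matrix.diagonal (fun i => (s i : ℂ)) * Vᴴ) ∧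
        (n + 1 = N → b.1 = 1 ∧ ∀ x i j j', T x i j = (a.2 * M.A n x) i j') := by
    intro n a
    by_cases hn : n + 1 = N
    · have h1 : M.D (n + 1) = 1 := by rw [hn, M.D_last]
      have := subsingleton_fin_of_eq_one h1
      refine ⟨⟨1, 0⟩, fun x => Matrix.of fun i _ => (a.2 * M.A n x) i ⟨0, by omega⟩, ?_, ?_⟩
      · intro h; omega
      · intro _
        refine ⟨rfl, fun x i j j' => ?_⟩
        exact congrArg ((a.2 * M.A n x) i) (Subsingleton.elim _ j')
    · obtain ⟨r, U, s, V, h⟩ := exists_isCompactSVD (leftMat fun x => a.2 * M.A n x)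
      exact ⟨⟨r, Matrix.diagonal (fun i => (s i : ℂ)) * Vᴴ⟩,
        fun x => Matrix.of fun i j => U (x, i) j, fun _ => ⟨s, V, h, rfl⟩, fun h => absurd h hn⟩
  obtain ⟨st, h0, hst⟩ := exists_forward_chain _ step ⟨1, fun _ _ => 1⟩
  choose T hT using hst
  refine ⟨⟨fun n => (st n).1, T, by simp [h0], ?_⟩, fun n => (st n).2, ?_, ?_, ?_⟩
  · cases N with
    | zero => simp [h0]
    | succ N => exact ((hT N).2 rfl).1
  · change ∀ i j, (st 0).2 i j = 1
    rw [h0]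
    intros; rfl
  · exact fun n hn => (hT n).1 hn
  · exact fun n hn => ((hT n).2 hn).2

theorem exists_sweepLeft {N : ℕ} (M : MPS N) : ∃ A, SweepLeft M A := by
  have step : ∀ n (b : Σ d, Matrix (Fin (M.D (n + 1))) (Fin d) ℂ),
      ∃ a : Σ d, Matrix (Fin (M.D n)) (Fin d) ℂ,
      ∃ T : Fin 2 → Matrix (Fin a.1) (Fin b.1) ℂ,
        (0 < n → ∃ (s : Fin a.1 → ℝ) (U : Matrix (Fin (M.D n)) (Fin a.1) ℂ),
          IsCompactSVD (rightMat fun x => M.A n x * b.2) U s (rightMat T)ᴴ ∧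
          a.2 = U * Matrix.diagonal (fun i => (s i : ℂ))) ∧
        (n = 0 → a.1 = 1 ∧ ∀ x i i' j, T x i j = (M.A n x * b.2) i' j /
          (Real.sqrt (∑ y, ∑ k, ∑ l, ‖(M.A n y * b.2) k l‖ ^ 2) : ℂ)) := by
    intro n b
    by_cases hn : n = 0
    · subst hn
      have := subsingleton_fin_of_eq_one M.D_zero
      refine ⟨⟨1, 0⟩, fun x => Matrix.of fun _ j =>
        (M.A 0 x * b.2) ⟨0, by rw [M.D_zero]; exact one_pos⟩ j /
          (Real.sqrt (∑ y, ∑ k, ∑ l, ‖(M.A 0 y * b.2) k l‖ ^ 2) : ℂ), ?_, ?_⟩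
      · intro h; omega
      · intro _
        refine ⟨rfl, fun x i i' j => ?_⟩
        rw [Subsingleton.elim i' ⟨0, by rw [M.D_zero]; exact one_pos⟩]
        rfl
    · obtain ⟨r, U, s, V, h⟩ := exists_isCompactSVD (rightMat fun x => M.A n x * b.2)
      refine ⟨⟨r, U * Matrix.diagonal (fun i => (s i : ℂ))⟩,
        fun x => Matrix.of fun i j => star (V (x, j) i), fun _ => ⟨s, U, ?_, rfl⟩, fun h => absurd h hn⟩
      have hV : (rightMat fun x => Matrix.of fun i j => star (V (x, j) i))ᴴ = V := by
        ext p i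
        simp [rightMat]
      rw [hV]
      exact h
  have : ∀ n, Nonempty (Σ d, Matrix (Fin (M.D n)) (Fin d) ℂ) := fun n => ⟨⟨1, 0⟩⟩
  obtain ⟨st, hN, hst⟩ := exists_backward_chain N
    (S := fun n => Σ d, Matrix (Fin (M.D n)) (Fin d) ℂ) _ step ⟨1, fun _ _ => 1⟩
  have hex : ∀ n, ∃ T : Fin 2 → Matrix (Fin (st n).1) (Fin (st (n + 1)).1) ℂ, n < N →
        (0 < n → ∃ (s : Fin (st n).1 → ℝ) (U : Matrix (Fin (M.D n)) (Fin (st n).1) ℂ),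
          IsCompactSVD (rightMat fun x => M.A n x * (st (n + 1)).2) U s (rightMat T)ᴴ ∧
          (st n).2 = U * Matrix.diagonal (fun i => (s i : ℂ))) ∧
        (n = 0 → (st n).1 = 1 ∧ ∀ x i i' j, T x i j = (M.A n x * (st (n + 1)).2) i' j /
          (Real.sqrt (∑ y, ∑ k, ∑ l, ‖(M.A n y * (st (n + 1)).2) k l‖ ^ 2) : ℂ)) := by
    intro n
    by_cases hn : n < N
    · obtain ⟨T, hT⟩ := hst n hn
      exact ⟨T, fun _ => hT⟩
    · exact ⟨0, fun h => absurd h hn⟩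
  choose T hT using hex
  refine ⟨⟨fun n => (st n).1, T, ?_, by simp [hN]⟩, fun n => (st n).2, ?_, ?_, ?_⟩
  · rcases Nat.eq_zero_or_pos N with h | h
    · subst h; simp [hN]
    · exact ((hT 0 h).2 rfl).1
  · change ∀ i j, (st N).2 i j = 1
    rw [hN]
    intros; rfl
  · exact fun n h0 hn => (hT n hn).1 h0
  · exact fun h => ((hT 0 h).2 rfl).2

/-! ### Amplitudes of matrix product states -/

namespace MPS

variable {N : ℕ} (M : MPS N)

/-- The product of the tensors of the sites `n, n + 1, …` along a word, applied to the all-ones vector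
of the right bond. -/
def suffixAmp : List (Fin 2) → (n : ℕ) → Fin (M.D n) → ℂ
  | [], _ => fun _ => 1
  | x :: w, n => M.A n x *ᵥ suffixAmp w (n + 1)

/-- The product of the tensors of the sites `0, …, n - 1` along a word, applied to the all-ones vector
of the left bond. -/
def prefixAmp : (n : ℕ) → (Fin n → Fin 2) → Fin (M.D n) → ℂ
  | 0, _ => fun _ => 1
  | n + 1, w => prefixAmp n (Fin.init w) ᵥ* M.A n (w (Fin.last n))

/-- The only index of the leftmost bond. -/
def origin : Fin (M.D 0) := ⟨0, by rw [M.D_zero]; exact one_pos⟩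

/-- The state that a matrix product state stands for. -/
def amp : Ket (Fin N) := fun w => M.suffixAmp (List.ofFn w) 0 M.origin

theorem sum_fin_D_zero (f : Fin (M.D 0) → ℂ) : ∑ i, f i = f M.origin := by
  have := subsingleton_fin_of_eq_one M.D_zero
  exact Fintype.sum_subsingleton f M.origin

/-- Cutting a word at the bond `n`. -/
theorem prefixAmp_dotProduct_suffixAmp (n : ℕ) (a : Fin n → Fin 2) (w : List (Fin 2)) :
    M.prefixAmp n a ⬝ᵥ M.suffixAmp w n = M.suffixAmp (List.ofFn a ++ w) 0 M.origin := by
  induction n generalizing w with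
  | zero =>
    rw [List.ofFn_zero, List.nil_append, dotProduct, sum_fin_D_zero]
    simp [prefixAmp]
  | succ n ih =>
    rw [prefixAmp, ← Matrix.dotProduct_mulVec]
    have := ih (Fin.init a) (a (Fin.last n) :: w)
    rw [suffixAmp] at this
    rw [this, List.ofFn_succ', List.concat_eq_append, List.append_assoc]
    rfl

end MPS

theorem rightMat_apply {a b : ℕ} (T : Fin 2 → Matrix (Fin a) (Fin b) ℂ) (x : Fin 2) (i : Fin a)
    (j : Fin b) : rightMat T i (x, j) = T x i j := rfl

theorem eq_mul_of_leftMat_eq {a b c : ℕ} {T : Fin 2 → Matrix (Fin a) (Fin b) ℂ}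
    {T' : Fin 2 → Matrix (Fin a) (Fin c) ℂ} {K : Matrix (Fin c) (Fin b) ℂ}
    (h : leftMat T = leftMat T' * K) (x : Fin 2) : T x = T' x * K := by
  ext i j
  have := congrFun (congrFun h (x, i)) j
  rw [Matrix.mul_apply] at this ⊢
  exact this

theorem eq_mul_of_rightMat_eq {a b c : ℕ} {T : Fin 2 → Matrix (Fin a) (Fin b) ℂ}
    {T' : Fin 2 → Matrix (Fin c) (Fin b) ℂ} {K : Matrix (Fin a) (Fin c) ℂ}
    (h : rightMat T = K * rightMat T') (x : Fin 2) : T x = K * T' x := by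
  ext i j
  have := congrFun (congrFun h i) (x, j)
  rw [Matrix.mul_apply] at this ⊢
  exact this

section Canonical

variable {N : ℕ}

namespace MPS

/-- The amplitudes of the suffixes of length `k` as a matrix with one row for each bond index. -/
def suffixMat (M : MPS N) (k n : ℕ) : Matrix (Fin (M.D n)) (Fin k → Fin 2) ℂ :=
  Matrix.of fun i w => M.suffixAmp (List.ofFn w) n i

/-- The amplitudes of the prefixes as a matrix with one column for each bond index. -/
def prefixMat (M : MPS N) (n : ℕ) : Matrix (Fin n → Fin 2) (Fin (M.D n)) ℂ :=
  Matrix.of fun w i => M.prefixAmp n w i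

/-- In a right-canonical matrix product state the amplitudes of suffixes have orthonormal rows. -/
theorem suffixMat_mul_conjTranspose {A : MPS N}
    (hA : ∀ n, n < N → rightMat (A.A n) * (rightMat (A.A n))ᴴ = 1) (k n : ℕ) (hn : n + k = N) :
    A.suffixMat k n * (A.suffixMat k n)ᴴ = 1 := by
  induction k generalizing n with
  | zero =>
    have h1 : A.D n = 1 := by rw [show n = N by omega, A.D_last]
    have := subsingleton_fin_of_eq_one h1
    ext i j
    rw [Subsingleton.elim j i, Matrix.one_apply_eq, Matrix.mul_apply, Fintype.sum_unique]
    simp [suffixMat, suffixAmp]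
  | succ k ih =>
    have hih := ih (n + 1) (by omega)
    ext i j
    have hx : ∀ x, ∑ w : Fin k → Fin 2, A.suffixMat (k + 1) n i (Fin.cons x w) *
        star (A.suffixMat (k + 1) n j (Fin.cons x w)) = (A.A n x * (A.A n x)ᴴ) i j := by
      intro x
      have h : ∀ i w, A.suffixMat (k + 1) n i (Fin.cons x w) =
          (A.A n x * A.suffixMat k (n + 1)) i w := by
        intro i w
        rw [suffixMat, Matrix.of_apply, List.ofFn_succ, suffixAmp]
        rfl
      simp only [h]
      calc _ = ((A.A n x * A.suffixMat k (n + 1)) * (A.A n x * A.suffixMat k (n + 1))ᴴ) i j := rfl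
        _ = _ := by
          rw [Matrix.conjTranspose_mul, Matrix.mul_assoc, ← Matrix.mul_assoc (A.suffixMat k (n + 1)),
            hih, Matrix.one_mul]
    rw [Matrix.mul_apply, sum_cons, ← hA n (by omega), Matrix.mul_apply, Fintype.sum_prod_type]
    exact Finset.sum_congr rfl fun x _ => hx x

/-- In a left-canonical matrix product state the amplitudes of prefixes have orthonormal columns. -/
theorem conjTranspose_mul_prefixMat {B : MPS N}
    (hB : ∀ n, n + 1 < N → (leftMat (B.A n))ᴴ * leftMat (B.A n) = 1) (n : ℕ) (hn : n < N) :
    (B.prefixMat n)ᴴ * B.prefixMat n = 1 := by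
  induction n with
  | zero =>
    have := subsingleton_fin_of_eq_one B.D_zero
    ext i j
    rw [Subsingleton.elim j i, Matrix.one_apply_eq, Matrix.mul_apply, Fintype.sum_unique]
    simp [prefixMat, prefixAmp]
  | succ n ih =>
    have hih := ih (by omega)
    ext i j
    have hx : ∀ x, ∑ w : Fin n → Fin 2, star (B.prefixMat (n + 1) (Fin.snoc w x) i) *
        B.prefixMat (n + 1) (Fin.snoc w x) j = ((B.A n x)ᴴ * B.A n x) i j := by
      intro x
      have h : ∀ i w, B.prefixMat (n + 1) (Fin.snoc w x) i = (B.prefixMat n * B.A n x) w i := by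
        intro i w
        rw [prefixMat, Matrix.of_apply, prefixAmp, Fin.init_snoc, Fin.snoc_last]
        rfl
      simp only [h]
      calc _ = ((B.prefixMat n * B.A n x)ᴴ * (B.prefixMat n * B.A n x)) i j := rfl
        _ = _ := by
          rw [Matrix.conjTranspose_mul, Matrix.mul_assoc, ← Matrix.mul_assoc (B.prefixMat n)ᴴ,
            hih, Matrix.one_mul]
    rw [Matrix.mul_apply, sum_snoc, Finset.sum_comm, ← hB n hn, Matrix.mul_apply,
      Fintype.sum_prod_type]
    exact Finset.sum_congr rfl fun x _ => hx x

/-- If the amplitudes of prefixes and of suffixes at the bond `n` are linearly independent, then the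
bond dimension does not exceed the Schmidt rank. -/
theorem D_le_schmidtRank (A : MPS N) {n : ℕ} (hn : n ≤ N)
    (L : Matrix (Fin (A.D n)) (Fin n → Fin 2) ℂ) (hL : L * A.prefixMat n = 1)
    (R : Matrix (Fin (N - n) → Fin 2) (Fin (A.D n)) ℂ) (hR : A.suffixMat (N - n) n * R = 1) :
    A.D n ≤ schmidtRank A.amp n := by
  obtain ⟨k, rfl⟩ := Nat.exists_eq_add_of_le hn
  have hk : n + k - n = k := by omega
  let r : (Fin n → Fin 2) → {i : Fin (n + k) // i.val < n} → Fin 2 := fun a i => a ⟨i.1, i.2⟩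
  let c : (Fin (n + k - n) → Fin 2) → {i : Fin (n + k) // ¬ i.val < n} → Fin 2 :=
    fun b i => b ⟨i.1 - n, by have := i.1.2; have := i.2; omega⟩
  have hsub : (reshape A.amp n).submatrix r c = A.prefixMat n * A.suffixMat (n + k - n) n := by
    ext a b
    rw [Matrix.mul_apply]
    change _ = A.prefixAmp n a ⬝ᵥ A.suffixAmp (List.ofFn b) n
    rw [prefixAmp_dotProduct_suffixAmp]
    simp only [Matrix.submatrix_apply, reshape, Matrix.of_apply, amp]
    congr 1
    refine List.ext_getElem (by simp) ?_
    intro i h1 h2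
    simp only [List.length_ofFn] at h1
    rw [List.getElem_ofFn, List.getElem_append]
    by_cases hi : i < n
    · simp [hi, r]
    · simp [hi, c]
  calc A.D n = (1 : Matrix (Fin (A.D n)) (Fin (A.D n)) ℂ).rank := by
        rw [Matrix.rank_one, Fintype.card_fin]
    _ = (L * ((reshape A.amp n).submatrix r c * R)).rank := by
        rw [hsub, Matrix.mul_assoc, hR, Matrix.mul_one, hL]
    _ ≤ ((reshape A.amp n).submatrix r c * R).rank := Matrix.rank_mul_le_right _ _
    _ ≤ ((reshape A.amp n).submatrix r c).rank := Matrix.rank_mul_le_left _ _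
    _ ≤ _ := Matrix.rank_submatrix_le _ _ _

end MPS

theorem one_le_schmidtRank {ψ : Ket (Fin N)} {w : Fin N → Fin 2} (hw : ψ w ≠ 0) (n : ℕ) :
    1 ≤ schmidtRank ψ n := by
  have h : ((reshape ψ n).submatrix (fun _ : Unit => fun i => w i) fun _ : Unit => fun i => w i) *
      (Matrix.of fun _ _ => (ψ w)⁻¹) = (1 : Matrix Unit Unit ℂ) := by
    ext
    rw [Matrix.mul_apply, Fintype.sum_unique, Matrix.submatrix_apply, reshape, Matrix.of_apply,
      Matrix.of_apply, Matrix.one_apply_eq]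
    simp only [dite_eq_ite, ite_self]
    exact mul_inv_cancel₀ hw
  calc 1 = (1 : Matrix Unit Unit ℂ).rank := by rw [Matrix.rank_one, Fintype.card_unit]
    _ ≤ _ := by
      rw [← h]
      exact (Matrix.rank_mul_le_left _ _).trans (Matrix.rank_submatrix_le _ _ _)

theorem SweepRight.leftMat_isometry {M B : MPS N} (h : SweepRight M B) (n : ℕ) (hn : n + 1 < N) :
    (leftMat (B.A n))ᴴ * leftMat (B.A n) = 1 := by
  obtain ⟨X, -, h2, -⟩ := h
  obtain ⟨s, V, h, -⟩ := h2 n hn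
  exact h.left

/-- The sweep to the right moves the matrix `X n` along the chain and does not change the state. -/
theorem SweepRight.amp_eq {M B : MPS N} (h : SweepRight M B) (w : Fin N → Fin 2) :
    B.amp w = M.amp w := by
  obtain ⟨X, h1, h2, h3⟩ := h
  have key : ∀ (l : List (Fin 2)) (n : ℕ), n < N → n + l.length = N →
      X n *ᵥ M.suffixAmp l n = B.suffixAmp l n := by
    intro l
    induction l with
    | nil => intro n hn hl; simp at hl; omega
    | cons x l ih =>
      intro n hn hl
      rw [List.length_cons] at hl
      rw [MPS.suffixAmp, MPS.suffixAmp, Matrix.mulVec_mulVec]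
      by_cases hlast : n + 1 = N
      · have hl0 : l = [] := List.length_eq_zero_iff.1 (by omega)
        subst hl0
        have hM1 : M.D (n + 1) = 1 := by rw [hlast, M.D_last]
        have hB1 : B.D (n + 1) = 1 := by rw [hlast, B.D_last]
        have := subsingleton_fin_of_eq_one hM1
        have := subsingleton_fin_of_eq_one hB1
        funext i
        rw [Matrix.mulVec, Matrix.mulVec, dotProduct, dotProduct,
          Fintype.sum_subsingleton _ (⟨0, by omega⟩ : Fin (M.D (n + 1))),
          Fintype.sum_subsingleton _ (⟨0, by omega⟩ : Fin (B.D (n + 1))),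
          h3 n hlast x i _ ⟨0, by omega⟩]
        rfl
      · obtain ⟨s, V, hsvd, hX⟩ := h2 n (by omega)
        have he : X n * M.A n x = B.A n x * X (n + 1) := by
          have := hsvd.eq
          rw [Matrix.mul_assoc, ← hX] at this
          exact eq_mul_of_leftMat_eq this x
        rw [he, ← Matrix.mulVec_mulVec, ih (n + 1) (by omega) (by omega)]
  rcases Nat.eq_zero_or_pos N with hN | hN
  · subst hN
    simp [MPS.amp, MPS.suffixAmp]
  · have := congrFun (key (List.ofFn w) 0 hN (by simp)) B.origin
    rw [MPS.amp, MPS.amp, ← this, Matrix.mulVec, dotProduct, MPS.sum_fin_D_zero, h1, one_mul]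

/-- After both sweeps all tensors are right-canonical, the state is the given one up to a positive
factor, and each bond dimension is at most the Schmidt rank: prefixes of `A` are
those of the left-canonical `B` times the injective matrix `U · diag(s)` carried along. -/
theorem sweeps_spec {M B A : MPS N} (hR : SweepRight M B) (hL : SweepLeft B A)
    (hne : ∃ w, M.amp w ≠ 0) :
    (∀ n, n < N → rightMat (A.A n) * (rightMat (A.A n))ᴴ = 1) ∧
    (∃ ν : ℝ, 0 < ν ∧ ∀ w, A.amp w = (ν : ℂ)⁻¹ * M.amp w) ∧
    ∀ n, n ≤ N → A.D n ≤ schmidtRank A.amp n := by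
  have hMB := hR.amp_eq
  have hB := hR.leftMat_isometry
  obtain ⟨Y, h1, h2, h3⟩ := hL
  have hmul : ∀ n, 0 < n → n < N → ∀ x, B.A n x * Y (n + 1) = Y n * A.A n x := by
    intro n h0 hn x
    obtain ⟨s, U, hsvd, hY⟩ := h2 n h0 hn
    have := hsvd.eq
    rw [Matrix.conjTranspose_conjTranspose, ← hY] at this
    exact eq_mul_of_rightMat_eq this x
  have key : ∀ (l : List (Fin 2)) (n : ℕ), 0 < n → n + l.length = N →
      Y n *ᵥ A.suffixAmp l n = B.suffixAmp l n := by
    intro l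
    induction l with
    | nil =>
      intro n h0 hl
      rw [List.length_nil, add_zero] at hl
      subst hl
      have := subsingleton_fin_of_eq_one A.D_last
      funext i
      rw [Matrix.mulVec, dotProduct, Fintype.sum_subsingleton _
        (⟨0, by rw [A.D_last]; exact one_pos⟩ : Fin (A.D n)), h1]
      simp [MPS.suffixAmp]
    | cons x l ih =>
      intro n h0 hl
      rw [List.length_cons] at hl
      rw [MPS.suffixAmp, MPS.suffixAmp, ← ih (n + 1) (by omega) (by omega), Matrix.mulVec_mulVec,
        Matrix.mulVec_mulVec, hmul n h0 (by omega)]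
  rcases Nat.eq_zero_or_pos N with hN | hN
  · subst hN
    have hamp : ∀ w, A.amp w = 1 := fun w => by simp [MPS.amp, MPS.suffixAmp]
    refine ⟨fun n hn => absurd hn (by omega), ⟨1, one_pos, fun w => ?_⟩, fun n hn => ?_⟩
    · simp [MPS.amp, MPS.suffixAmp]
    · obtain rfl : n = 0 := by omega
      rw [A.D_zero]
      exact one_le_schmidtRank (w := 0) (by rw [hamp]; exact one_ne_zero) 0
  set ν : ℝ := Real.sqrt (∑ y, ∑ k, ∑ l, ‖(B.A 0 y * Y 1) k l‖ ^ 2) with hν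
  have h3 : ∀ x i i' j, A.A 0 x i j = (B.A 0 x * Y 1) i' j / (ν : ℂ) := h3 hN
  have hamp : ∀ w, A.amp w = (ν : ℂ)⁻¹ * M.amp w := by
    intro w
    obtain ⟨N, rfl⟩ := Nat.exists_eq_add_one.2 hN
    rw [← hMB, MPS.amp, MPS.amp, List.ofFn_succ, MPS.suffixAmp, MPS.suffixAmp,
      ← key _ 1 one_pos (by simp; omega), Matrix.mulVec_mulVec, Matrix.mulVec, Matrix.mulVec,
      dotProduct, dotProduct, Finset.mul_sum]
    refine Finset.sum_congr rfl fun j _ => ?_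
    rw [h3 _ _ B.origin]
    ring
  -- otherwise the state would vanish; this excludes a division by zero in the normalization
  have hν0 : ν ≠ 0 := by
    intro h
    obtain ⟨w, hw⟩ := hne
    refine hw ?_
    have h0 : ∀ x, B.A 0 x * Y 1 = 0 := by
      intro x
      rw [hν, Real.sqrt_eq_zero (by positivity)] at h
      ext k l
      have e1 := (Finset.sum_eq_zero_iff_of_nonneg fun y _ => by positivity).1 h x
        (Finset.mem_univ _)
      have e2 := (Finset.sum_eq_zero_iff_of_nonneg fun y _ => by positivity).1 e1 k
        (Finset.mem_univ _)
      have e3 := (Finset.sum_eq_zero_iff_of_nonneg fun y _ => by positivity).1 e2 l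
        (Finset.mem_univ _)
      simpa using e3
    obtain ⟨N, rfl⟩ := Nat.exists_eq_add_one.2 hN
    rw [← hMB, MPS.amp, List.ofFn_succ, MPS.suffixAmp, ← key _ 1 one_pos (by simp; omega),
      Matrix.mulVec_mulVec, h0, Matrix.zero_mulVec]
    rfl
  have hνpos : 0 < ν := lt_of_le_of_ne (Real.sqrt_nonneg _) hν0.symm
  have hcanon : ∀ n, n < N → rightMat (A.A n) * (rightMat (A.A n))ᴴ = 1 := by
    intro n hn
    rcases Nat.eq_zero_or_pos n with h0 | h0
    · subst h0
      have := subsingleton_fin_of_eq_one A.D_zero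
      ext i j
      rw [Subsingleton.elim j i, Matrix.one_apply_eq, Matrix.mul_apply, Fintype.sum_prod_type]
      have hsum : ∑ y, ∑ l, ‖(B.A 0 y * Y 1) B.origin l‖ ^ 2 = ν ^ 2 := by
        have := subsingleton_fin_of_eq_one B.D_zero
        rw [hν, Real.sq_sqrt (by positivity)]
        exact Finset.sum_congr rfl fun y _ => (Fintype.sum_subsingleton
          (fun k => ∑ l, ‖(B.A 0 y * Y 1) k l‖ ^ 2) B.origin).symm
      have hterm : ∀ x j', rightMat (A.A 0) i (x, j') * (rightMat (A.A 0))ᴴ (x, j') i =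
          ((‖(B.A 0 x * Y 1) B.origin j'‖ ^ 2 : ℝ) : ℂ) * ((ν : ℂ) ^ 2)⁻¹ := by
        intro x j'
        rw [Matrix.conjTranspose_apply, rightMat_apply, h3 x i B.origin j', Complex.star_def,
          Complex.mul_conj, Complex.normSq_eq_norm_sq, norm_div, Complex.norm_real,
          Real.norm_eq_abs, div_pow, sq_abs]
        push_cast
        rw [div_eq_mul_inv]
      simp only [hterm]
      simp only [← Finset.sum_mul, ← Complex.ofReal_sum]
      rw [hsum]
      push_cast
      exact mul_inv_cancel₀ (pow_ne_zero 2 (by exact_mod_cast hν0))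
    · obtain ⟨s, U, hsvd, -⟩ := h2 n h0 hn
      have := hsvd.right
      rwa [Matrix.conjTranspose_conjTranspose] at this
  refine ⟨hcanon, ⟨ν, hνpos, hamp⟩, ?_⟩
  -- the matrix carried along by the second sweep relates the prefixes of `A` to those of `B`
  have hpre : ∀ n, 0 < n → n ≤ N → (ν : ℂ) • A.prefixMat n = Matrix.of (fun a i =>
      (B.prefixAmp n a ᵥ* Y n) i) := by
    intro n h0
    induction n with
    | zero => omega
    | succ n ih =>
      intro hn
      ext a j
      rw [Matrix.smul_apply, Matrix.of_apply, MPS.prefixMat, Matrix.of_apply, MPS.prefixAmp,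
        MPS.prefixAmp, Matrix.vecMul_vecMul]
      rcases Nat.eq_zero_or_pos n with h | h
      · subst h
        rw [Matrix.vecMul, Matrix.vecMul, dotProduct, dotProduct, MPS.sum_fin_D_zero,
          MPS.sum_fin_D_zero, h3 _ _ B.origin]
        simp only [MPS.prefixAmp, one_mul, smul_eq_mul]
        have : (ν : ℂ) ≠ 0 := by exact_mod_cast hν0
        field_simp
      · rw [hmul n h (by omega), ← Matrix.vecMul_vecMul]
        have := congrFun (ih h (by omega)) (Fin.init a)
        have h' : (ν : ℂ) • A.prefixAmp n (Fin.init a) = B.prefixAmp n (Fin.init a) ᵥ* Y n := this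
        rw [← h', Matrix.smul_vecMul]
        rfl
  have hw0 : ∃ w, A.amp w ≠ 0 := by
    obtain ⟨w, hw⟩ := hne
    refine ⟨w, ?_⟩
    rw [hamp]
    exact mul_ne_zero (inv_ne_zero (by exact_mod_cast hν0)) hw
  obtain ⟨w0, hw0⟩ := hw0
  intro n hn
  by_cases hend : n = 0 ∨ n = N
  · rw [show A.D n = 1 by rcases hend with rfl | rfl; exacts [A.D_zero, A.D_last]]
    exact one_le_schmidtRank hw0 n
  · have h0 : 0 < n := by omega
    have hlt : n < N := by omega
    obtain ⟨s, U, hsvd, hY⟩ := h2 n h0 hlt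
    refine A.D_le_schmidtRank hn ((ν : ℂ) • (Matrix.diagonal (fun i => ((s i : ℂ))⁻¹) * Uᴴ *
      (B.prefixMat n)ᴴ)) ?_ _ (MPS.suffixMat_mul_conjTranspose hcanon (N - n) n (by omega))
    have e : (ν : ℂ) • A.prefixMat n = B.prefixMat n * Y n := hpre n h0 hn
    rw [Matrix.smul_mul, ← Matrix.mul_smul, e, Matrix.mul_assoc, ← Matrix.mul_assoc (B.prefixMat n)ᴴ,
      MPS.conjTranspose_mul_prefixMat hB n hlt, Matrix.one_mul, hY, Matrix.mul_assoc,
      ← Matrix.mul_assoc Uᴴ, hsvd.left, Matrix.one_mul, Matrix.diagonal_mul_diagonal,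
      ← Matrix.diagonal_one]
    congr 1
    funext i
    exact inv_mul_cancel₀ (by exact_mod_cast (hsvd.pos i).ne')

end Canonical

/-! ### Matrix product states of automata -/

section Automata

variable {N : ℕ}

theorem mem_wordsOfLength {L : Language (Fin 2)} {w : Fin N → Fin 2} :
    w ∈ wordsOfLength L N ↔ List.ofFn w ∈ L := Iff.rfl

namespace PDFA

/-- The words accepted from the state `p`. -/
def AcceptsFrom (F : PDFA) (p : Fin F.numStates) (w : List (Fin 2)) : Prop :=
  ∃ q ∈ F.accept, F.run p w = some q

theorem acceptsFrom_cons (F : PDFA) (p : Fin F.numStates) (x : Fin 2) (w : List (Fin 2)) :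
    F.AcceptsFrom p (x :: w) ↔ ∃ q, F.step p x = some q ∧ F.AcceptsFrom q w := by
  simp only [AcceptsFrom, run, Option.bind_eq_some_iff]
  constructor
  · rintro ⟨q, hq, p', h1, h2⟩
    exact ⟨p', h1, q, hq, h2⟩
  · rintro ⟨p', h1, q, hq, h2⟩
    exact ⟨q, hq, p', h1, h2⟩

theorem toMPS_A_apply (F : PDFA) (n : ℕ) (x : Fin 2) (i : Fin ((F.toMPS N).D n))
    (j : Fin ((F.toMPS N).D (n + 1))) : (F.toMPS N).A n x i j = ∑ p : Fin F.numStates,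
      ∑ q : Fin F.numStates,
      (if n = 0 then (if p = F.start then 1 else 0) else (if p.val = i.val then 1 else 0)) *
      (if F.step p x = some q then 1 else 0) *
      (if n + 1 = N then (if q ∈ F.accept then 1 else 0) else (if q.val = j.val then 1 else 0)) :=
  rfl

open Classical in
/-- The suffix amplitude at bond `n` tells whether the suffix is accepted from the state that labels the
bond index; at `n = 0` this state is the initial one. -/
theorem toMPS_suffixAmp (F : PDFA) (w : List (Fin 2)) (n : ℕ) (hn : n < N)
    (hw : n + w.length = N) (i : Fin ((F.toMPS N).D n)) :
    (F.toMPS N).suffixAmp w n i = ∑ p : Fin F.numStates,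
      (if n = 0 then (if p = F.start then 1 else 0) else (if p.val = i.val then 1 else 0)) *
      (if F.AcceptsFrom p w then (1 : ℂ) else 0) := by
  induction w generalizing n with
  | nil => rw [List.length_nil] at hw; omega
  | cons x w ih =>
    rw [List.length_cons] at hw
    -- the sum over the right bond: at the last site it is the acceptance test for the state `q`
    have hinner : ∀ q : Fin F.numStates, ∑ j, (if n + 1 = N then (if q ∈ F.accept then 1 else 0)
        else (if q.val = j.val then 1 else 0)) * (F.toMPS N).suffixAmp w (n + 1) j =
        if F.AcceptsFrom q w then (1 : ℂ) else 0 := by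
      intro q
      by_cases hlast : n + 1 = N
      · obtain rfl : w = [] := List.length_eq_zero_iff.1 (by omega)
        have h1 : (F.toMPS N).D (n + 1) = 1 := by rw [hlast, (F.toMPS N).D_last]
        have := subsingleton_fin_of_eq_one h1
        rw [Fintype.sum_subsingleton _ (⟨0, by omega⟩ : Fin ((F.toMPS N).D (n + 1))), if_pos hlast]
        simp [MPS.suffixAmp, AcceptsFrom, run]
      · have hD : (F.toMPS N).D (n + 1) = F.numStates := by simp [toMPS, hlast]
        simp only [if_neg hlast]
        rw [Finset.sum_eq_single (Fin.cast hD.symm q)]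
        · rw [ih (n + 1) (by omega) (by omega), Finset.sum_eq_single q]
          · simp
          · intro p _ hp
            have : p.val ≠ q.val := fun h => hp (Fin.ext h)
            simp [this]
          · simp
        · intro j _ hj
          rw [if_neg, zero_mul]
          intro h
          exact hj (Fin.ext h.symm)
        · simp
    have hacc : ∀ p : Fin F.numStates, (if F.AcceptsFrom p (x :: w) then (1 : ℂ) else 0) =
        ∑ q, (if F.step p x = some q then 1 else 0) * if F.AcceptsFrom q w then (1 : ℂ) else 0 := by
      intro p
      rw [acceptsFrom_cons]
      cases hs : F.step p x with
      | none => simp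
      | some p' =>
        rw [Finset.sum_eq_single p']
        · simp
        · intro q _ hq
          rw [if_neg (fun h => hq (Option.some.inj h).symm), zero_mul]
        · simp
    simp only [hacc, ← hinner]
    rw [MPS.suffixAmp, Matrix.mulVec, dotProduct]
    simp only [toMPS_A_apply, Finset.mul_sum, Finset.sum_mul]
    rw [Finset.sum_comm]
    refine Finset.sum_congr rfl fun p _ => ?_
    rw [Finset.sum_comm]
    refine Finset.sum_congr rfl fun q _ => Finset.sum_congr rfl fun j _ => ?_
    ring

open Classical in
/-- For `N = 0` the amplitude of the empty word is one for every automaton, whence the hypothesis. -/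
theorem toMPS_amp (F : PDFA) (hne : (wordsOfLength F.language N).Nonempty) (w : Fin N → Fin 2) :
    (F.toMPS N).amp w = if w ∈ wordsOfLength F.language N then 1 else 0 := by
  rcases Nat.eq_zero_or_pos N with hN | hN
  · subst hN
    obtain ⟨w', hw'⟩ := hne
    rw [Subsingleton.elim w w', if_pos hw']
    simp [MPS.amp, MPS.suffixAmp]
  · rw [MPS.amp, toMPS_suffixAmp F _ 0 hN (by simp)]
    simp only [if_true, ite_mul, one_mul, zero_mul, Finset.sum_ite_eq', Finset.mem_univ]
    rfl

end PDFA

namespace DagDFA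

/-- The state of layer `n` that is reached by reading `n` letters. -/
def reached (G : DagDFA N) : (n : ℕ) → (Fin n → Fin 2) → Option (Fin (G.width n))
  | 0, _ => some ⟨0, by rw [G.width_zero]; exact one_pos⟩
  | n + 1, w => (reached G n (Fin.init w)).bind fun p => G.step n p (w (Fin.last n))

/-- The amplitudes of prefixes in the matrix product state of a layered automaton, labelled by the
states of its layers. -/
def prefixAmp (G : DagDFA N) (n : ℕ) (w : Fin n → Fin 2) : Fin (G.width n) → ℂ :=
  G.toMPS.prefixAmp n w

theorem prefixAmp_succ (G : DagDFA N) (n : ℕ) (w : Fin (n + 1) → Fin 2) (j : Fin (G.width (n + 1))) :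
    G.prefixAmp (n + 1) w j = ∑ i, G.prefixAmp n (Fin.init w) i *
      if G.step n i (w (Fin.last n)) = some j then 1 else 0 := rfl

theorem sum_prefixAmp (G : DagDFA N) (w : Fin N → Fin 2) :
    ∑ i, G.prefixAmp N w i = G.toMPS.amp w := by
  have h := G.toMPS.prefixAmp_dotProduct_suffixAmp N w []
  rw [List.append_nil] at h
  rw [MPS.amp, ← h, dotProduct]
  exact Finset.sum_congr rfl fun i _ => (mul_one _).symm

theorem prefixAmp_eq (G : DagDFA N) (n : ℕ) (w : Fin n → Fin 2) (j : Fin (G.width n)) :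
    G.prefixAmp n w j = if G.reached n w = some j then 1 else 0 := by
  induction n with
  | zero =>
    have := subsingleton_fin_of_eq_one G.width_zero
    rw [reached, if_pos (congrArg some (Subsingleton.elim _ _))]
    rfl
  | succ n ih =>
    rw [prefixAmp_succ, reached]
    simp only [ih]
    cases h : G.reached n (Fin.init w) with
    | none => simp
    | some p =>
      rw [Finset.sum_eq_single p]
      · simp
      · intro i _ hi
        rw [if_neg (fun h => hi (Option.some.inj h).symm), zero_mul]
      · intro h; exact absurd (Finset.mem_univ _) h

/-- As the automaton is deterministic, a complete run is the sequence of the reached states. -/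
theorem mem_words_iff (G : DagDFA N) (w : Fin N → Fin 2) :
    w ∈ G.words ↔ (G.reached N w).isSome := by
  have hsucc : ∀ n (hn : n + 1 ≤ N), G.reached (n + 1) (w ∘ Fin.castLE hn) =
      (G.reached n (w ∘ Fin.castLE (n.le_succ.trans hn))).bind fun p => G.step n p (w ⟨n, hn⟩) :=
    fun n hn => rfl
  constructor
  · rintro ⟨q, hq⟩
    have key : ∀ n (hn : n ≤ N), G.reached n (w ∘ Fin.castLE hn) = some (q ⟨n, by omega⟩) := by
      intro n
      induction n with
      | zero =>
        intro _
        have := subsingleton_fin_of_eq_one G.width_zero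
        exact congrArg some (Subsingleton.elim _ _)
      | succ n ih =>
        intro hn
        rw [hsucc, ih, Option.bind_some]
        exact hq ⟨n, hn⟩
    have := key N le_rfl
    change G.reached N w = _ at this
    rw [this]
    rfl
  · intro h
    have key : ∀ k n (hn : n ≤ N), n + k = N → (G.reached n (w ∘ Fin.castLE hn)).isSome := by
      intro k
      induction k with
      | zero =>
        intro n hn hk
        obtain rfl : n = N := hk
        exact h
      | succ k ih =>
        intro n hn hk
        have := ih (n + 1) (by omega) (by omega)
        rw [hsucc] at this
        exact Option.isSome_of_isSome_bind this
    have key' := fun n hn => key (N - n) n hn (by omega)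
    refine ⟨fun i => (G.reached i (w ∘ Fin.castLE (by omega))).get (key' i (by omega)), fun i => ?_⟩
    have h1 := hsucc i i.2
    have h2 : G.reached i (w ∘ Fin.castLE (by omega)) =
        some ((G.reached i (w ∘ Fin.castLE (by omega))).get (key' i (by omega))) := by simp
    rw [h2, Option.bind_some] at h1
    refine h1.symm.trans ?_
    simp only [Fin.val_succ, Option.some_get]

open Classical in
theorem toMPS_amp (G : DagDFA N) (w : Fin N → Fin 2) :
    G.toMPS.amp w = if w ∈ G.words then 1 else 0 := by
  rw [← sum_prefixAmp, mem_words_iff]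
  simp only [prefixAmp_eq]
  cases h : G.reached N w <;> simp

end DagDFA

/-! ### Existence of automata -/

theorem exists_pdfa {L : Language (Fin 2)} (hL : L.IsRegular) : ∃ F : PDFA, F.language = L := by
  classical
  obtain ⟨σ, _, M, rfl⟩ := hL
  let e := Fintype.equivFin σ
  let F : PDFA :=
    { numStates := Fintype.card σ
      step := fun q x => some (e (M.step (e.symm q) x))
      start := e M.start
      accept := Finset.univ.filter fun q => e.symm q ∈ M.accept }
  have hrun : ∀ (w : List (Fin 2)) (s : σ), F.run (e s) w = some (e (M.evalFrom s w)) := by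
    intro w
    induction w with
    | nil => intro s; rfl
    | cons x w ih =>
      intro s
      rw [PDFA.run]
      change (some (e (M.step (e.symm (e s)) x))).bind (fun p => F.run p w) = _
      rw [Option.bind_some, e.symm_apply_apply, ih, DFA.evalFrom_cons]
  refine ⟨F, ?_⟩
  ext w
  change (∃ q ∈ F.accept, F.run (e M.start) w = some q) ↔ M.evalFrom M.start w ∈ M.accept
  rw [hrun]
  constructor
  · rintro ⟨q, hq, h⟩
    rw [← Option.some.inj h] at hq
    have := (Finset.mem_filter.1 hq).2
    rwa [e.symm_apply_apply] at this
  · intro h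
    refine ⟨_, Finset.mem_filter.2 ⟨Finset.mem_univ _, ?_⟩, rfl⟩
    rwa [e.symm_apply_apply]

/-- The prefixes of length `i`, which are the states of layer `i` of a prefix tree; all states of the
last layer are merged into one, represented by the zero word. -/
abbrev TreeState (N i : ℕ) : Type := {w : Fin i → Fin 2 // i = N → w = 0}

open Classical in
/-- The transitions of the prefix tree: a letter is appended to the prefix; at the last letter, membership
in `L` decides whether there is a transition. -/
def treeNext (L : Language (Fin 2)) {N i : ℕ} (s : TreeState N i) (x : Fin 2) :
    Option (TreeState N (i + 1)) :=
  if h : i + 1 = N then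
    if List.ofFn (Fin.snoc s.1 x : Fin (i + 1) → Fin 2) ∈ L then some ⟨0, fun _ => rfl⟩ else none
  else some ⟨Fin.snoc s.1 x, fun h' => absurd h' h⟩

/-- The layered automaton for the words of length `N` of `L` whose other layers form a complete
prefix tree. -/
def treeDagDFA (L : Language (Fin 2)) (N : ℕ) : DagDFA N where
  width i := Fintype.card (TreeState N i)
  step i p x := (treeNext L ((Fintype.equivFin (TreeState N i)).symm p) x).map
    (Fintype.equivFin (TreeState N (i + 1)))
  width_zero := Fintype.card_eq_one_iff.2
    ⟨⟨0, fun _ => rfl⟩, fun _ => Subtype.ext (Subsingleton.elim _ _)⟩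
  width_last := Fintype.card_eq_one_iff.2 ⟨⟨0, fun _ => rfl⟩, fun w => Subtype.ext (w.2 rfl)⟩

/-- The number of a prefix among the states of its layer. -/
def treeIndex (L : Language (Fin 2)) {N i : ℕ} (s : TreeState N i) :
    Fin ((treeDagDFA L N).width i) :=
  Fintype.equivFin (TreeState N i) s

theorem treeDagDFA_step (L : Language (Fin 2)) {N i : ℕ} (s : TreeState N i) (x : Fin 2) :
    (treeDagDFA L N).step i (treeIndex L s) x = (treeNext L s x).map (treeIndex L) :=
  congrArg (fun s => (treeNext L s x).map (treeIndex L))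
    ((Fintype.equivFin (TreeState N i)).symm_apply_apply s)

theorem treeDagDFA_reached (L : Language (Fin 2)) (N n : ℕ) (hn : n < N) (w : Fin n → Fin 2) :
    (treeDagDFA L N).reached n w = some (treeIndex L ⟨w, fun h => absurd h hn.ne⟩) := by
  induction n with
  | zero =>
    have := subsingleton_fin_of_eq_one (treeDagDFA L N).width_zero
    exact congrArg some (Subsingleton.elim _ _)
  | succ n ih =>
    have hsn : (Fin.snoc (Fin.init w) (w (Fin.last n)) : Fin (n + 1) → Fin 2) = w :=
      Fin.snoc_init_self w
    rw [DagDFA.reached, ih (by omega), Option.bind_some, treeDagDFA_step, treeNext, dif_neg hn.ne]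
    simp only [hsn, Option.map_some]

/-- For `N = 0` every layered automaton has the empty word, whence the hypothesis. -/
theorem treeDagDFA_words (L : Language (Fin 2)) (N : ℕ) (hne : (wordsOfLength L N).Nonempty) :
    (treeDagDFA L N).words = wordsOfLength L N := by
  ext w
  rw [DagDFA.mem_words_iff]
  rcases Nat.eq_zero_or_pos N with hN | hN
  · subst hN
    obtain ⟨w', hw'⟩ := hne
    rw [Subsingleton.elim w w']
    simp [hw', DagDFA.reached]
  · obtain ⟨N, rfl⟩ := Nat.exists_eq_add_one.2 hN
    rw [DagDFA.reached, treeDagDFA_reached L (N + 1) N (by omega), Option.bind_some]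
    have hsn : (Fin.snoc (Fin.init w) (w (Fin.last N)) : Fin (N + 1) → Fin 2) = w :=
      Fin.snoc_init_self w
    rw [treeDagDFA_step, treeNext, dif_pos rfl, mem_wordsOfLength]
    have hmem := congrArg (fun u => List.ofFn u ∈ L) hsn
    split_ifs with h
    · exact iff_of_true rfl (hmem.mp h)
    · exact iff_of_false Bool.false_ne_true fun h' => h (hmem.mpr h')

theorem exists_minimal_pdfa (F : PDFA) : ∃ G : PDFA, G.IsMinimal ∧ G.language = F.language := by
  classical
  have hex : ∃ n, ∃ G : PDFA, G.language = F.language ∧ G.numStates = n := ⟨_, F, rfl, rfl⟩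
  obtain ⟨G, h1, h2⟩ := Nat.find_spec hex
  refine ⟨G, fun H hH => ?_, h1⟩
  rw [h2]
  exact Nat.find_min' hex ⟨H, hH.trans h1, rfl⟩

theorem exists_minimal_dagDFA (F : DagDFA N) : ∃ G : DagDFA N, G.IsMinimal ∧ G.words = F.words := by
  classical
  have hex : ∃ n, ∃ G : DagDFA N, G.words = F.words ∧ G.numStates = n := ⟨_, F, rfl, rfl⟩
  obtain ⟨G, h1, h2⟩ := Nat.find_spec hex
  refine ⟨G, fun H hH => ?_, h1⟩
  rw [h2]
  exact Nat.find_min' hex ⟨H, hH.trans h1, rfl⟩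

theorem wordsOfLength_targetLanguage (L : Language (Fin 2)) (compl : Bool) :
    wordsOfLength (targetLanguage L compl) N =
      if compl then (wordsOfLength L N)ᶜ else wordsOfLength L N := by
  cases compl <;> rfl

theorem exists_initialMPS {L : Language (Fin 2)} (hL : L.IsRegular) {inp : Input N}
    (hinp : inp.Describes L) {compl : Bool}
    (hne : (wordsOfLength (targetLanguage L compl) N).Nonempty) : ∃ M, inp.InitialMPS compl M := by
  have hreg : (targetLanguage L compl).IsRegular := by
    cases compl
    exacts [hL, hL.compl]
  obtain ⟨G, hG1, hG2⟩ := exists_minimal_dagDFA (treeDagDFA (targetLanguage L compl) N)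
  rw [treeDagDFA_words _ _ hne, wordsOfLength_targetLanguage] at hG2
  obtain ⟨F₀, hF₀⟩ := exists_pdfa hreg
  obtain ⟨F, hF1, hF2⟩ := exists_minimal_pdfa F₀
  rw [hF₀] at hF2
  cases inp with
  | strings S =>
    refine ⟨_, G, hG1, ?_, rfl⟩
    rw [hG2, show (S : Set (Fin N → Fin 2)) = wordsOfLength L N from hinp]
  | regex r =>
    refine ⟨_, F, hF1, ?_, rfl⟩
    rw [hF2, show r.matches' = L from hinp]
  | dfa F' =>
    refine ⟨_, F, hF1, ?_, rfl⟩
    rw [hF2, show F'.language = L from hinp]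
  | dagDFA G' =>
    refine ⟨_, G, hG1, ?_, rfl⟩
    rw [hG2, show G'.words = wordsOfLength L N from hinp]

open Classical in
/-- The initial matrix product state has amplitude one on the target words and zero elsewhere. -/
theorem Input.InitialMPS.amp_eq {L : Language (Fin 2)} {inp : Input N}
    (hinp : inp.Describes L) {compl : Bool} {M : MPS N} (hM : inp.InitialMPS compl M)
    (hne : (wordsOfLength (targetLanguage L compl) N).Nonempty) (w : Fin N → Fin 2) :
    M.amp w = if w ∈ wordsOfLength (targetLanguage L compl) N then 1 else 0 := by
  cases inp with
  | strings S =>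
    obtain ⟨G, -, hG, rfl⟩ := hM
    rw [show (S : Set (Fin N → Fin 2)) = wordsOfLength L N from hinp,
      ← wordsOfLength_targetLanguage] at hG
    rw [DagDFA.toMPS_amp, hG]
  | regex r =>
    obtain ⟨F, -, hF, rfl⟩ := hM
    rw [show r.matches' = L from hinp] at hF
    rw [PDFA.toMPS_amp F (by rwa [hF]), hF]
  | dfa F' =>
    obtain ⟨F, -, hF, rfl⟩ := hM
    rw [show F'.language = L from hinp] at hF
    rw [PDFA.toMPS_amp F (by rwa [hF]), hF]
  | dagDFA G' =>
    obtain ⟨G, -, hG, rfl⟩ := hM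
    rw [show G'.words = wordsOfLength L N from hinp, ← wordsOfLength_targetLanguage] at hG
    rw [DagDFA.toMPS_amp, hG]

end Automata

/-! ### Padding of tensors -/

theorem le_two_pow_bondQubits (d : ℕ) : d ≤ 2 ^ bondQubits d := Nat.le_pow_clog one_lt_two d

theorem two_pow_bondQubits_le {d χ : ℕ} (hd : d ≤ χ) (hχ : 1 ≤ χ) : 2 ^ bondQubits d ≤ 2 * χ := by
  rcases Nat.lt_or_ge 1 d with h | h
  · have h1 := Nat.pow_pred_clog_lt_self one_lt_two h
    have h2 : 0 < Nat.clog 2 d := Nat.clog_pos one_lt_two h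
    obtain ⟨k, hk⟩ := Nat.exists_eq_add_one.2 h2
    rw [bondQubits, hk, pow_succ]
    rw [hk, Nat.pred_succ] at h1
    omega
  · rw [bondQubits, Nat.clog_of_right_le_one h, pow_zero]
    omega

/-- A sum over a bond of dimension `d` as a sum over the bit strings that encode it. -/
theorem sum_code {M : Type*} [AddCommMonoid M] {k d : ℕ} (hd : d ≤ 2 ^ k) (f : Fin d → M) :
    ∑ β : Fin k → Fin 2, (if h : code β < d then f ⟨code β, h⟩ else 0) = ∑ j, f j := by
  have hcode : ∀ j : Fin d, code (finFunctionFinEquiv.symm (Fin.castLE hd j) : Fin k → Fin 2) = j := by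
    intro j
    rw [code, Equiv.apply_symm_apply]
    rfl
  symm
  refine Fintype.sum_of_injective
    (fun j => (finFunctionFinEquiv.symm (Fin.castLE hd j) : Fin k → Fin 2)) ?_ _ _ ?_ ?_
  · intro i j hij
    exact Fin.castLE_injective hd (finFunctionFinEquiv.symm.injective hij)
  · intro β hβ
    rw [dif_neg]
    intro h
    refine hβ ⟨⟨code β, h⟩, ?_⟩
    exact finFunctionFinEquiv.symm_apply_apply β
  · intro j
    have h : code (finFunctionFinEquiv.symm (Fin.castLE hd j) : Fin k → Fin 2) < d := by
      rw [hcode]; exact j.2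
    rw [dif_pos h]
    exact congrArg f (Fin.ext (hcode j).symm)

theorem bondQubits_le_of_rightMat {a b : ℕ} {T : Fin 2 → Matrix (Fin a) (Fin b) ℂ}
    (hT : rightMat T * (rightMat T)ᴴ = 1) : bondQubits a ≤ bondQubits b + 1 := by
  have h : a ≤ 2 * b := by
    calc a = (1 : Matrix (Fin a) (Fin a) ℂ).rank := by rw [Matrix.rank_one, Fintype.card_fin]
      _ ≤ (rightMat T).rank := by rw [← hT]; exact Matrix.rank_mul_le_left _ _
      _ ≤ Fintype.card (Fin 2 × Fin b) := Matrix.rank_le_card_width _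
      _ = 2 * b := by simp
  refine Nat.clog_le_of_le_pow (h.trans ?_)
  have := le_two_pow_bondQubits b
  rw [pow_succ]
  omega

theorem code_injective {k : ℕ} : Function.Injective (code : (Fin k → Fin 2) → ℕ) :=
  Fin.val_injective.comp finFunctionFinEquiv.injective

/-- The rows of a right-canonical tensor are orthonormal, and extend to an orthonormal basis. -/
theorem exists_isPadding {a b : ℕ} {T : Fin 2 → Matrix (Fin a) (Fin b) ℂ}
    (hT : rightMat T * (rightMat T)ᴴ = 1) : ∃ V, IsPadding T V := by
  have hinj := padZeros_injective (bondQubits_le_of_rightMat hT)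
  let row : (Fin (bondQubits a) → Fin 2) → (Fin (bondQubits b + 1) → Fin 2) → ℂ := fun α y =>
    if hα : code α < a then
      if hβ : code (Fin.tail y) < b then T (y 0) ⟨code α, hα⟩ ⟨code (Fin.tail y), hβ⟩ else 0 else 0
  let v : (Fin (bondQubits b + 1) → Fin 2) → EuclideanSpace ℂ (Fin (bondQubits b + 1) → Fin 2) :=
    Function.extend (padZeros (bondQubits b + 1)) (fun α => WithLp.toLp 2 (row α)) 0
  have hv : ∀ α, v (padZeros (bondQubits b + 1) α) = WithLp.toLp 2 (row α) :=
    fun α => hinj.extend_apply _ _ α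
  let s : Set (Fin (bondQubits b + 1) → Fin 2) :=
    {i | ∃ α : Fin (bondQubits a) → Fin 2, code α < a ∧ padZeros (bondQubits b + 1) α = i}
  have hon : Orthonormal ℂ (s.domRestrict v) := by
    rw [orthonormal_iff_ite]
    rintro ⟨_, α, hα, rfl⟩ ⟨_, α', hα', rfl⟩
    have hsum : ∀ x, ∑ w : Fin (bondQubits b) → Fin 2, row α' (Fin.cons x w) *
        star (row α (Fin.cons x w)) = ∑ j, T x ⟨code α', hα'⟩ j * star (T x ⟨code α, hα⟩ j) := by
      intro x
      rw [← sum_code (le_two_pow_bondQubits b)]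
      refine Finset.sum_congr rfl fun w _ => ?_
      simp only [row, dif_pos hα, dif_pos hα', Fin.tail_cons, Fin.cons_zero]
      split_ifs <;> simp
    have hT' := congrFun (congrFun hT ⟨code α', hα'⟩) ⟨code α, hα⟩
    rw [Matrix.mul_apply, Fintype.sum_prod_type, Matrix.one_apply] at hT'
    simp only [Set.domRestrict_apply, hv]
    rw [EuclideanSpace.inner_toLp_toLp, dotProduct]
    simp only [Pi.star_apply]
    rw [sum_cons]
    simp only [hsum]
    refine (hT'.trans ?_)
    congr 1
    rw [eq_iff_iff, Fin.mk.injEq, Subtype.mk.injEq, hinj.eq_iff, code_injective.eq_iff, eq_comm]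
  obtain ⟨B, hB⟩ := hon.exists_orthonormalBasis_extension_of_card_eq (by simp)
  refine ⟨Matrix.of fun y α => B (padZeros (bondQubits b + 1) α) y, ?_, ?_⟩
  · ext α α'
    have := orthonormal_iff_ite.1 B.orthonormal (padZeros (bondQubits b + 1) α)
      (padZeros (bondQubits b + 1) α')
    simp only [hinj.eq_iff] at this
    rw [Matrix.one_apply, ← this, Matrix.mul_apply, PiLp.inner_apply]
    refine Finset.sum_congr rfl fun y _ => ?_
    rw [RCLike.inner_apply, mul_comm]
    rfl
  · intro α hα x β
    rw [Matrix.of_apply, hB _ ⟨α, hα, rfl⟩, hv]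
    simp only [row, dif_pos hα, Fin.tail_cons, Fin.cons_zero]

/-! ### The sequential circuit -/

theorem window_zero (n : ℕ) : window 0 n = Fin.valEmbedding := by
  ext i; simp [window]

theorem window_apply (n m : ℕ) (i : Fin m) : window n m i = n + i := rfl

theorem IsPadding.bondQubits_le {a b : ℕ} {T : Fin 2 → Matrix (Fin a) (Fin b) ℂ}
    {V : Matrix (Fin (bondQubits b + 1) → Fin 2) (Fin (bondQubits a) → Fin 2) ℂ}
    (h : IsPadding T V) : bondQubits a ≤ bondQubits b + 1 := by
  have : 2 ^ bondQubits a ≤ 2 ^ (bondQubits b + 1) := by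
    calc 2 ^ bondQubits a = (1 : Matrix (Fin (bondQubits a) → Fin 2) _ ℂ).rank := by
          rw [Matrix.rank_one]; simp
      _ ≤ V.rank := by rw [← h.1]; exact Matrix.rank_mul_le_right _ _
      _ ≤ _ := Matrix.rank_le_card_height _
      _ = _ := by simp
  exact (Nat.pow_le_pow_iff_right one_lt_two).1 this

/-- A circuit on the first `m` of `k` qubits acts on a basis vector whose other qubits are zero. -/
theorem relabel_castLE_mulVec_ket {a m k : ℕ} (ham : a ≤ m) (hmk : m ≤ k) (c : Circuit (Fin m))
    (α : Fin a → Fin 2) (y : Fin k → Fin 2) :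
    (Circuit.matrix (c.relabel (Fin.castLEEmb hmk)) *ᵥ ket (padZeros k α)) y =
      if ∀ j : Fin k, m ≤ j.val → y j = 0 then
        (c.matrix *ᵥ ket (padZeros m α)) (y ∘ Fin.castLE hmk) else 0 := by
  rw [Circuit.relabel_mulVec]
  have hin : ∀ (z : Fin m → Fin 2) (i : Fin m),
      Function.extend (Fin.castLEEmb hmk) z y (Fin.castLE hmk i) = z i :=
    fun z i => (Fin.castLEEmb hmk).injective.extend_apply z y i
  have hout : ∀ (z : Fin m → Fin 2) (j : Fin k), m ≤ j.val →
      Function.extend (Fin.castLEEmb hmk) z y j = y j := by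
    intro z j hj
    rw [Function.extend_apply']
    rintro ⟨i, rfl⟩
    exact absurd i.2 (not_lt.2 hj)
  split_ifs with h
  · have : (fun z => ket (padZeros k α) (Function.extend (Fin.castLEEmb hmk) z y)) =
        ket (padZeros m α) := by
      funext z
      rw [ket_apply, ket_apply]
      congr 1
      rw [eq_iff_iff]
      constructor
      · intro he
        funext i
        have := congrFun he (Fin.castLE hmk i)
        rw [hin] at this
        exact this
      · rintro rfl
        funext j
        rcases Nat.lt_or_ge j.val m with hj | hj
        · exact hin _ ⟨j, hj⟩
        · rw [hout _ j hj, h j hj, padZeros, dif_neg (by omega)]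
    rw [this]
    rfl
  · have : (fun z => ket (padZeros k α) (Function.extend (Fin.castLEEmb hmk) z y)) = 0 := by
      funext z
      rw [ket_apply, if_neg]
      · rfl
      · intro he
        refine h fun j hj => ?_
        rw [← hout z j hj, he, padZeros, dif_neg (by omega)]
    rw [this, Matrix.mulVec_zero]
    rfl

theorem extend_succ_cons {k : ℕ} (z : Fin k → Fin 2) (w : Fin (k + 1) → Fin 2) :
    Function.extend (Fin.succEmb k) z w = Fin.cons (w 0) z := by
  funext j
  refine Fin.cases ?_ (fun i => ?_) j
  · rw [Function.extend_apply', Fin.cons_zero]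
    rintro ⟨i, hi⟩
    exact Fin.succ_ne_zero i hi
  · rw [Fin.cons_succ]
    exact (Fin.succEmb k).injective.extend_apply z w i

/-- The circuits of the sites `n, …, N - 1` turn the left bond state `|α⟩` of site `n` into the state
of the tensors from site `n` on. The circuit of site `n` leaves its letter on the first qubit and the
state of the next bond on the qubits after it, where the other circuits find it. -/
theorem exists_sequential_circuit {N : ℕ} (A : MPS N)
    (V : (n : ℕ) → Matrix (Fin (bondQubits (A.D (n + 1)) + 1) → Fin 2)
      (Fin (bondQubits (A.D n)) → Fin 2) ℂ)
    (hV : ∀ n, n < N → IsPadding (A.A n) (V n)) {χ : ℕ} (hχ : 1 ≤ χ) (hD : ∀ n, n ≤ N → A.D n ≤ χ)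
    (k n : ℕ) (hn : n + k = N) : bondQubits (A.D n) ≤ k ∧ ∃ c : Circuit (Fin k),
      ((List.range' n k).flatMap fun i =>
        (lnnSynthesis.circuit (V i)).relabel (window i _)) = c.relabel (window n k) ∧
      c.IsLNN ∧ c.size ≤ k * (824 * χ ^ 2) ∧
      ∀ (α : Fin (bondQubits (A.D n)) → Fin 2) (hα : code α < A.D n),
        c.matrix *ᵥ ket (padZeros k α) = fun w => A.suffixAmp (List.ofFn w) n ⟨code α, hα⟩ := by
  induction k generalizing n with
  | zero =>
    have h1 : A.D n = 1 := by rw [show n = N by omega, A.D_last]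
    refine ⟨by rw [h1]; exact le_of_eq (Nat.clog_of_right_le_one le_rfl _), [], rfl, Circuit.isLNN_nil,
      Nat.zero_le _, ?_⟩
    intro α hα
    rw [Circuit.nil_mulVec]
    funext w
    rw [ket_apply, if_pos (Subsingleton.elim _ _), List.ofFn_zero]
    rfl
  | succ k ih =>
    obtain ⟨hk, c, hc1, hc2, hc3, hc4⟩ := ih (n + 1) (by omega)
    have hpad := hV n (by omega)
    have ha := hpad.bondQubits_le
    have hmk : bondQubits (A.D (n + 1)) + 1 ≤ k + 1 := by omega
    refine ⟨ha.trans hmk, (lnnSynthesis.circuit (V n)).relabel (Fin.castLEEmb hmk) ++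
      c.relabel (Fin.succEmb k), ?_, Circuit.isLNN_append
        (Circuit.relabel_isLNN (lnnSynthesis_isLNN _) _ 0 fun i => rfl)
        (Circuit.relabel_isLNN hc2 _ 1 fun i => rfl), ?_, ?_⟩
    · rw [List.range'_succ, List.flatMap_cons, hc1, Circuit.relabel_append, Circuit.relabel_relabel,
        Circuit.relabel_relabel]
      congr 2
      ext i
      simp only [window_apply, Function.Embedding.trans_apply, Fin.coe_succEmb, Fin.val_succ]
      omega
    · rw [Circuit.size_append, Circuit.size_relabel, Circuit.size_relabel]
      have h1 := lnnSynthesis_size (V n)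
      have h2 := two_pow_bondQubits_le (hD n (by omega)) hχ
      have h3 := two_pow_bondQubits_le (hD (n + 1) (by omega)) hχ
      -- a bond of dimension at most `χ` is rounded up to at most `2 * χ`, whence `824 = 103 * 2 * 2 * 2`
      have h4 : 103 * 2 ^ (bondQubits (A.D (n + 1)) + 1 + bondQubits (A.D n)) ≤ 824 * χ ^ 2 := by
        calc 103 * 2 ^ (bondQubits (A.D (n + 1)) + 1 + bondQubits (A.D n))
            = 206 * (2 ^ bondQubits (A.D (n + 1)) * 2 ^ bondQubits (A.D n)) := by ring
          _ ≤ 206 * ((2 * χ) * (2 * χ)) := by gcongr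
          _ = 824 * χ ^ 2 := by ring
      rw [add_mul, one_mul]
      omega
    · intro α hα
      rw [Circuit.append_mulVec]
      funext w
      rw [Circuit.relabel_mulVec]
      simp only [extend_succ_cons, relabel_castLE_mulVec_ket ha hmk,
        lnnSynthesis.correct (V n) (Nat.succ_pos _) ha hpad.1]
      have htail : w ∘ Fin.succEmb k = Fin.tail w := rfl
      -- seen from the remaining qubits, the state is a superposition of states of the next bond
      have hstate : (fun z : Fin k → Fin 2 =>
          if ∀ j : Fin (k + 1), bondQubits (A.D (n + 1)) + 1 ≤ j.val →
              (Fin.cons (w 0) z : Fin (k + 1) → Fin 2) j = 0 then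
            V n ((Fin.cons (w 0) z : Fin (k + 1) → Fin 2) ∘ Fin.castLE hmk) α else 0) =
          ∑ β : Fin (bondQubits (A.D (n + 1))) → Fin 2,
            (V n (Fin.cons (w 0) β) α) • ket (padZeros k β) := by
        funext z
        rw [Finset.sum_apply]
        simp only [Pi.smul_apply, ket_apply, smul_eq_mul, mul_ite, mul_one, mul_zero]
        split_ifs with h
        · have hz : z = padZeros k (z ∘ Fin.castLE hk) := by
            funext j
            rw [padZeros]
            split_ifs with hj
            · rfl
            · have := h j.succ (by rw [Fin.val_succ]; omega)
              rwa [Fin.cons_succ] at this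
          rw [Finset.sum_eq_single (z ∘ Fin.castLE hk)]
          · rw [if_pos hz]
            congr 1
            funext j
            refine Fin.cases ?_ (fun i => ?_) j
            · rfl
            · rfl
          · intro β _ hβ
            rw [if_neg]
            intro h'
            exact hβ (padZeros_injective hk (h'.symm.trans hz))
          · intro h'; exact absurd (Finset.mem_univ _) h'
        · symm
          refine Finset.sum_eq_zero fun β _ => ?_
          rw [if_neg]
          rintro rfl
          refine h fun j => ?_
          refine Fin.cases ?_ (fun i => ?_) j
          · intro hj; simp at hj
          · intro hj
            rw [Fin.cons_succ, padZeros, dif_neg]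
            rw [Fin.val_succ] at hj
            omega
      rw [hstate, Matrix.mulVec_sum, Finset.sum_apply, htail, List.ofFn_succ, MPS.suffixAmp,
        Matrix.mulVec, dotProduct, ← sum_code (le_two_pow_bondQubits _)]
      refine Finset.sum_congr rfl fun β _ => ?_
      rw [Matrix.mulVec_smul, Pi.smul_apply, hpad.2 α hα]
      split_ifs with hβ
      · rw [hc4 β hβ]
        rfl
      · rw [zero_smul]

/-! ### Depth, normalization and complements -/

theorem Circuit.clocks_le {ι : Type} [DecidableEq ι] (c : Circuit ι) (t : ι → ℕ) (M : ℕ)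
    (ht : ∀ q, t q ≤ M) (q : ι) : c.clocks t q ≤ M + c.size := by
  induction c generalizing t M with
  | nil => exact ht q
  | cons g c ih =>
    have h := ih (fun q => if q ∈ g.support then g.support.sup t + 1 else t q) (M + 1) (by
      intro q
      split_ifs
      · have : g.support.sup t ≤ M := Finset.sup_le fun q _ => ht q
        omega
      · have := ht q
        omega)
    have hsize : Circuit.size (g :: c) = Circuit.size c + 1 := rfl
    rw [hsize]
    change Circuit.clocks c _ q ≤ _
    omega

theorem Circuit.depth_le_size {ι : Type} [Fintype ι] [DecidableEq ι] (c : Circuit ι) :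
    c.depth ≤ c.size :=
  Finset.sup_le fun q _ => (c.clocks_le _ 0 (fun _ => le_rfl) q).trans (by omega)

open Classical in
/-- A right-canonical matrix product state is normalized, so a positive multiple of an indicator
function is the uniform superposition. -/
theorem amp_eq_uniformState {N : ℕ} {A : MPS N}
    (hA : ∀ n, n < N → rightMat (A.A n) * (rightMat (A.A n))ᴴ = 1) {S : Set (Fin N → Fin 2)} {ν : ℝ}
    (hν : 0 < ν) (h : ∀ w, A.amp w = (ν : ℂ)⁻¹ * if w ∈ S then 1 else 0) : A.amp = uniformState S := by
  have hnorm := congrFun (congrFun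
    (MPS.suffixMat_mul_conjTranspose hA N 0 (by omega)) A.origin) A.origin
  rw [Matrix.one_apply_eq, Matrix.mul_apply] at hnorm
  have hterm : ∀ w, A.suffixMat N 0 A.origin w * (A.suffixMat N 0)ᴴ w A.origin =
      ((ν : ℂ) ^ 2)⁻¹ * if w ∈ S then 1 else 0 := by
    intro w
    change A.amp w * star (A.amp w) = _
    rw [h]
    split_ifs
    · rw [mul_one, star_inv₀, Complex.star_def, Complex.conj_ofReal, ← mul_inv, sq, mul_one]
    · simp
  simp only [hterm] at hnorm
  rw [← Finset.mul_sum, Finset.sum_boole] at hnorm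
  have hcard : (ν : ℂ) ^ 2 = ((Finset.univ.filter fun w => w ∈ S).card : ℂ) := by
    have : (ν : ℂ) ^ 2 ≠ 0 := pow_ne_zero 2 (by exact_mod_cast hν.ne')
    rw [inv_mul_eq_div, div_eq_one_iff_eq this] at hnorm
    exact hnorm.symm
  have hS : S.ncard = (Finset.univ.filter fun w => w ∈ S).card := by
    rw [← Set.ncard_coe_finset]
    simp
  have hsq : Real.sqrt (S.ncard : ℝ) = ν := by
    rw [hS, ← Real.sqrt_sq hν.le]
    congr 1
    exact_mod_cast hcard.symm
  funext w
  rw [h, uniformState, hsq]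
  split_ifs <;> simp

theorem rank_add_le {m n : Type} [Fintype m] [Fintype n] (P Q : Matrix m n ℂ) :
    (P + Q).rank ≤ P.rank + Q.rank := by
  rw [Matrix.rank, Matrix.rank, Matrix.rank, Matrix.mulVecLin_add]
  exact (Submodule.finrank_mono (LinearMap.range_add_le _ _)).trans
    (Submodule.finrank_add_le_finrank_add_finrank _ _)

/-- Up to factors, the matrix of the complement is the all-ones matrix minus that of the set. -/
theorem schmidtRank_compl_le {N : ℕ} {S : Set (Fin N → Fin 2)} (hS : S.Nonempty) (n : ℕ) :
    schmidtRank (uniformState Sᶜ) n ≤ 1 + schmidtRank (uniformState S) n := by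
  set s : ℂ := ((1 / Real.sqrt (S.ncard : ℝ) : ℝ) : ℂ) with hs
  set t : ℂ := ((1 / Real.sqrt (Sᶜ.ncard : ℝ) : ℝ) : ℂ) with ht
  have hs0 : s ≠ 0 := by
    have h1 : 0 < S.ncard := (Set.ncard_pos (Set.toFinite S)).2 hS
    have h2 : 0 < 1 / Real.sqrt (S.ncard : ℝ) := by positivity
    rw [hs]
    exact_mod_cast h2.ne'
  have hval : ∀ w, uniformState Sᶜ w = t * 1 + uniformState S w * (-(t / s)) := by
    intro w
    simp only [uniformState, ← hs, ← ht]
    by_cases hw : w ∈ S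
    · rw [if_pos hw, if_neg (Set.notMem_compl_iff.2 hw)]
      field_simp
      ring
    · rw [if_neg hw, if_pos (Set.mem_compl hw)]
      ring
  have hmat : reshape (uniformState Sᶜ) n = Matrix.vecMulVec (fun _ => t) (fun _ => 1) +
      reshape (uniformState S) n * Matrix.diagonal fun _ => -(t / s) := by
    ext a b
    exact (hval _).trans (congrArg _ (Matrix.mul_diagonal (fun _ => -(t / s))
      (reshape (uniformState S) n) a b).symm)
  rw [schmidtRank, hmat]
  exact (rank_add_le _ _).trans (add_le_add (Matrix.rank_vecMulVec_le _ _)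
    (Matrix.rank_mul_le_left _ _))

theorem uniformState_ne_zero {N : ℕ} {S : Set (Fin N → Fin 2)} {w : Fin N → Fin 2} (hw : w ∈ S) :
    uniformState S w ≠ 0 := by
  have h1 : 0 < S.ncard := (Set.ncard_pos (Set.toFinite S)).2 ⟨w, hw⟩
  have h2 : 0 < 1 / Real.sqrt (S.ncard : ℝ) := by positivity
  simp only [uniformState, hw, if_true]
  exact_mod_cast h2.ne'

theorem schmidtRank_le_max {N : ℕ} (ψ : Ket (Fin N)) {n : ℕ} (hn : n ≤ N) :
    schmidtRank ψ n ≤ maxSchmidtRank ψ :=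
  Finset.le_sup (f := schmidtRank ψ) (Finset.mem_range.2 (by omega))

theorem one_le_maxSchmidtRank {N : ℕ} {S : Set (Fin N → Fin 2)} (hS : S.Nonempty) :
    1 ≤ maxSchmidtRank (uniformState S) := by
  obtain ⟨w, hw⟩ := hS
  exact (one_le_schmidtRank (uniformState_ne_zero hw) 0).trans (schmidtRank_le_max _ (Nat.zero_le _))

theorem maxSchmidtRank_targetLanguage_le {N : ℕ} {L : Language (Fin 2)} (compl : Bool)
    (hL : (wordsOfLength L N).Nonempty) :
    maxSchmidtRank (rls (targetLanguage L compl) N) ≤ 2 * maxSchmidtRank (rls L N) := by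
  have h1 : 1 ≤ maxSchmidtRank (rls L N) := one_le_maxSchmidtRank hL
  cases compl with
  | false =>
    change maxSchmidtRank (rls L N) ≤ _
    omega
  | true =>
    refine Finset.sup_le fun n hn => ?_
    have h2 := schmidtRank_compl_le hL n
    have h3 := schmidtRank_le_max (rls L N) (Nat.lt_succ_iff.1 (Finset.mem_range.1 hn))
    change schmidtRank (uniformState (wordsOfLength L N)ᶜ) n ≤ _
    rw [rls] at h1 h3 ⊢
    omega

/-- The pipeline has an output: regularity gives an automaton, singular value decompositions exist, and
right-canonical tensors have paddings. -/
theorem exists_seqRLSP {N : ℕ} {L : Language (Fin 2)} (synth : IsometrySynthesis) (hL : L.IsRegular)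
    {inp : Input N} (hinp : inp.Describes L) {compl : Bool}
    (hne : (wordsOfLength (targetLanguage L compl) N).Nonempty) : ∃ c, SeqRLSP synth inp compl c := by
  classical
  obtain ⟨M, hM⟩ := exists_initialMPS hL hinp hne
  obtain ⟨B, hB⟩ := exists_sweepRight M
  obtain ⟨A, hA⟩ := exists_sweepLeft B
  have hamp := hM.amp_eq hinp hne
  obtain ⟨w, hw⟩ := hne
  obtain ⟨hcan, -, -⟩ := sweeps_spec hB hA ⟨w, by rw [hamp, if_pos hw]; exact one_ne_zero⟩
  have hV : ∀ n, ∃ V, n < N → IsPadding (A.A n) V := by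
    intro n
    by_cases hn : n < N
    · obtain ⟨V, hV⟩ := exists_isPadding (hcan n hn)
      exact ⟨V, fun _ => hV⟩
    · exact ⟨0, fun h => absurd h hn⟩
  choose V hV using hV
  exact ⟨_, M, B, A, V, hM, hB, hA, hV, rfl⟩

/-- Every output of the pipeline is a nearest-neighbour circuit of at most `824 χ² N` gates that
prepares the target state. -/
theorem SeqRLSP.exists_circuit {N : ℕ} {L : Language (Fin 2)} {inp : Input N}
    (hinp : inp.Describes L) {compl : Bool}
    (hne : (wordsOfLength (targetLanguage L compl) N).Nonempty) {c : Circuit ℕ}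
    (hc : SeqRLSP lnnSynthesis inp compl c) :
    ∃ c' : Circuit (Fin N), c = c'.relabel Fin.valEmbedding ∧ c'.IsLNN ∧
      c'.Prepares (rls (targetLanguage L compl) N) ∧
      c'.size ≤ 824 * maxSchmidtRank (rls (targetLanguage L compl) N) ^ 2 * N := by
  classical
  obtain ⟨M, B, A, V, hM, hB, hA, hV, rfl⟩ := hc
  have hamp := hM.amp_eq hinp hne
  obtain ⟨w, hw⟩ := id hne
  obtain ⟨hcan, ⟨ν, hν, hνamp⟩, hD⟩ :=
    sweeps_spec hB hA ⟨w, by rw [hamp, if_pos hw]; exact one_ne_zero⟩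
  have hA' : A.amp = rls (targetLanguage L compl) N :=
    amp_eq_uniformState hcan hν fun w => by rw [hνamp, hamp]
  rw [hA'] at hD
  obtain ⟨-, c', h1, h2, h3, h4⟩ := exists_sequential_circuit A V hV
    (one_le_maxSchmidtRank hne) (fun n hn => (hD n hn).trans (schmidtRank_le_max _ hn)) N 0 (by omega)
  refine ⟨c', ?_, h2, ?_, ?_⟩
  · rw [List.range_eq_range', h1, window_zero]
  · have hb : bondQubits (A.D 0) = 0 := by
      rw [A.D_zero]; exact Nat.clog_of_right_le_one le_rfl _
    have hzero : padZeros N (0 : Fin (bondQubits (A.D 0)) → Fin 2) = 0 := by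
      funext i
      rw [padZeros]
      split_ifs <;> rfl
    have hcode : code (0 : Fin (bondQubits (A.D 0)) → Fin 2) < A.D 0 := by
      have h5 := (finFunctionFinEquiv (0 : Fin (bondQubits (A.D 0)) → Fin 2)).2
      have h6 : 2 ^ bondQubits (A.D 0) = A.D 0 := by rw [hb, A.D_zero, pow_zero]
      exact h5.trans_eq h6
    have := h4 0 hcode
    rw [hzero] at this
    unfold Circuit.Prepares
    rw [this, ← hA']
    funext w
    have hsub := subsingleton_fin_of_eq_one A.D_zero
    rw [MPS.amp]
    congr 1
    exact Subsingleton.elim _ _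
  · exact h3.trans_eq (mul_comm _ _)

end RLSP

end

theorem mainTheorem2 :
    ∃ (synth : RLSP.IsometrySynthesis) (C : ℕ),
      ∀ (N : ℕ) (L : Language (Fin 2)), L.IsRegular →
      ∀ inp : RLSP.Input N, inp.Describes L →
      ∀ compl : Bool, (RLSP.wordsOfLength (RLSP.targetLanguage L compl) N).Nonempty →
        (∃ c : RLSP.Circuit ℕ, RLSP.SeqRLSP synth inp compl c) ∧
        ∀ c : RLSP.Circuit ℕ, RLSP.SeqRLSP synth inp compl c →
          ∃ c' : RLSP.Circuit (Fin N),
            c = c'.relabel Fin.valEmbedding ∧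
            c'.IsLNN ∧
            c'.Prepares (RLSP.rls (RLSP.targetLanguage L compl) N) ∧
            c'.size ≤ C * RLSP.maxSchmidtRank (RLSP.rls (RLSP.targetLanguage L compl) N) ^ 2 * N ∧
            c'.depth ≤ C * RLSP.maxSchmidtRank (RLSP.rls (RLSP.targetLanguage L compl) N) ^ 2 * N ∧
            ((RLSP.wordsOfLength L N).Nonempty →
              c'.size ≤ C * RLSP.maxSchmidtRank (RLSP.rls L N) ^ 2 * N ∧
              c'.depth ≤ C * RLSP.maxSchmidtRank (RLSP.rls L N) ^ 2 * N) := by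
  -- `3296 = 4 * 824`: the maximal Schmidt rank of the target is at most twice that of `L`.
  refine ⟨RLSP.lnnSynthesis, 3296, fun N L hL inp hinp compl hne =>
    ⟨RLSP.exists_seqRLSP _ hL hinp hne, fun c hc => ?_⟩⟩
  obtain ⟨c', h1, h2, h3, h4⟩ := RLSP.SeqRLSP.exists_circuit hinp hne hc
  have hd := RLSP.Circuit.depth_le_size c'
  have hs : c'.size ≤ 3296 * RLSP.maxSchmidtRank (RLSP.rls (RLSP.targetLanguage L compl) N) ^ 2 * N :=
    h4.trans (by gcongr; norm_num)
  refine ⟨c', h1, h2, h3, hs, hd.trans hs, fun hLne => ?_⟩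
  have hs' : c'.size ≤ 3296 * RLSP.maxSchmidtRank (RLSP.rls L N) ^ 2 * N := by
    calc c'.size ≤ 824 * RLSP.maxSchmidtRank (RLSP.rls (RLSP.targetLanguage L compl) N) ^ 2 * N := h4
      _ ≤ 824 * (2 * RLSP.maxSchmidtRank (RLSP.rls L N)) ^ 2 * N := by
        gcongr
        exact RLSP.maxSchmidtRank_targetLanguage_le compl hLne
      _ = _ := by ring
  exact ⟨hs', hd.trans hs'⟩
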